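/- **Theorem.** Let $n\ge 1$, write $[n]=\{1,\dots,n\}$ and $[\pm n]=\{\pm1,\dots,\pm n\}$, and let $\mathfrak S_n^B$ be the group of signed permutations, i.e. permutations $\sigma$ of $[\pm n]$ with $\sigma(-i)=-\sigma(i)$. Let $s_0$ exchange $1$ and $-1$, and for $1\le i\le n-1$ let $s_i$ exchange $i$ with $i+1$ and $-i$ with $-(i+1)$, all other elements being fixed. The length $\ell(\sigma)$ is the least $k$ such that $\sigma$ is a product of $k$ of the generators $s_0,\dots,s_{n-1}$, and $$\mathrm{inv}(\sigma)=\#\{(i,j)\in[n]^2: i<j,\ \sigma(i)>\sigma(j)\}+\#\{(i,j)\in[n]^2: i\le j,\ \sigma(-i)>\sigma(j)\}.$$ For $0\le k\le n$, a *$(k,n)$-diagram* is a left-justified diagram of boxes in a $k\times(n-k)$ rectangle with row lengths $\lambda_1\ge\dots\ge\lambda_k\ge0$. Number the unit steps of its southeast border $1,\dots,n$ from the northeast to the southwest corner of the rectangle; each row and each column gets the number of its border step as its label. The *shifted* diagram is obtained by adding a staircase of boxes on top, the $j$th column from the left receiving $n-k-j+1$ additional boxes; the topmost box of each column is called a *diagonal*,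 and the added row whose diagonal lies in column $i$ is labeled $-i$. A *permutation tableau of type $B$ of length $n$* is a filling of a shifted $(k,n)$-diagram (for some $k$) with $0$'s and $1$'s such that (1) every column contains a $1$; (2) a box with a $1$ above it in its column and a $1$ to the left of it in its row contains a $1$; (3) if a diagonal contains a $0$, its row contains no $1$. Let $\mathcal{PT}_n^B$ be the set of these tableaux. The *zigzag path* from a row (column) of $\mathcal T$ enters the row at its left end moving east (the column at its top moving south), switches between east and south whenever it meets a $1$, and ends when it reaches the right end of a row or the bottom of a column. Define $\zeta(\mathcal T)\in\mathfrak S_n^B$ as follows, for $i\in[n]$: if $i$ is a row label, $\zeta(\mathcal T)(i)$ is the label of the row or column where the zigzag path from row $i$ ends; if $-i$ is a row label and row $-i$ has $0$ in its diagonal, $\zeta(\mathcal T)(i)$ is the label where the path from column $i$ ends; if $-i$ is a row label and row $-i$ has $1$ in its diagonal, $\zeta(\mathcal T)(-i)$ is the label where the path from row $-i$ ends. Through each $0$ of $\mathcal T$ pass two zigzag paths, one horizontally and one vertically; let $\mathrm{zero}_{EE}(\mathcal T)$ (respectively $\mathrm{zero}_{NN}(\mathcal T)$) be the number of $0$'s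 for which both paths start from rows (respectively both from columns), and let $\mathrm{one}(\mathcal T)$ be the number of $1$'s in $\mathcal T$. Then for every $\sigma\in\mathfrak S_n^B$ there is a unique $\mathcal T=\zeta^{-1}(\sigma)\in\mathcal{PT}_n^B$ with $\zeta(\mathcal T)=\sigma$, and $$\ell(\sigma)=\mathrm{inv}(\sigma)=2\bigl(\mathrm{zero}_{EE}(\mathcal T)+\mathrm{zero}_{NN}(\mathcal T)\bigr)+\mathrm{one}(\mathcal T).$$ -/

import Mathlib

/-! ### Signed permutations -/

/-- The set `[±n] = {±1, …, ±n}`. -/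
abbrev PM (n : ℕ) : Type := {z : ℤ // z ≠ 0 ∧ -(n : ℤ) ≤ z ∧ z ≤ n}

namespace PM

noncomputable instance instFintype (n : ℕ) : Fintype (PM n) :=
  Fintype.subtype ((Finset.Icc (-(n : ℤ)) n).filter (fun z => z ≠ 0)) (by
    intro z
    simp only [Finset.mem_filter, Finset.mem_Icc]
    tauto)

instance instNeg (n : ℕ) : Neg (PM n) :=
  ⟨fun x => ⟨-x.1, by have := x.2; omega⟩⟩

@[simp] theorem val_neg {n : ℕ} (x : PM n) : (-x).1 = -x.1 := rfl

end PM

/-- The group of signed permutations: permutations `σ` of `[±n]` with `σ(-i) = -σ(i)`. -/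
def SignedPerm (n : ℕ) : Subgroup (Equiv.Perm (PM n)) where
  carrier := {σ | ∀ x, σ (-x) = -σ x}
  one_mem' := fun _ => rfl
  mul_mem' := by
    intro a b ha hb x
    simp only [Set.mem_ofPred_eq] at ha hb
    simp [Equiv.Perm.mul_apply, ha, hb]
  inv_mem' := by
    intro a ha x
    simp only [Set.mem_ofPred_eq] at ha
    rw [Equiv.Perm.inv_eq_iff_eq, ha]
    simp

namespace SignedPerm

/-- `s₀` exchanges `1` and `-1`; for `i ≥ 1`, `sᵢ` exchanges `i` with `i + 1` and
`-i` with `-(i + 1)`. -/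
def simpleFun (i : ℤ) (x : ℤ) : ℤ :=
  if i = 0 then (if x = 1 ∨ x = -1 then -x else x)
  else if x = i then i + 1
  else if x = i + 1 then i
  else if x = -i then -(i + 1)
  else if x = -(i + 1) then -i
  else x

/-- `simpleFun` as a self-map of `[±n]`, for `i ∈ {0, …, n - 1}`. -/
def simpleMap {n : ℕ} (i : Fin n) (x : PM n) : PM n :=
  ⟨simpleFun (i.1 : ℤ) x.1, by
    have h1 := x.2
    have h2 := i.2
    unfold simpleFun
    split_ifs <;> omega⟩

theorem simpleMap_involutive {n : ℕ} (i : Fin n) :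
    Function.Involutive (simpleMap i) := by
  intro x
  apply Subtype.ext
  have h1 := x.2
  have h2 := i.2
  simp only [simpleMap, simpleFun]
  split_ifs <;> omega

/-- The generator `sᵢ` of the group of signed permutations, `i ∈ {0, …, n - 1}`. -/
def simple {n : ℕ} (i : Fin n) : SignedPerm n :=
  ⟨(simpleMap_involutive i).toPerm, by
    intro x
    apply Subtype.ext
    have h1 := x.2
    have h2 := i.2
    simp only [Function.Involutive.coe_toPerm, simpleMap, simpleFun, PM.val_neg]
    split_ifs <;> omega⟩

/-- The length `ℓ(σ)`: the least `k` such that `σ` is a product of `k` generators. -/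
noncomputable def length {n : ℕ} (σ : SignedPerm n) : ℕ :=
  sInf {k | ∃ w : List (Fin n), w.length = k ∧ (w.map simple).prod = σ}

/-- The number of inversions `inv(σ)`: the pairs `i < j` in `[n]` with `σ(i) > σ(j)`, together with
the pairs `i ≤ j` in `[n]` with `σ(-i) > σ(j)`. A pair that satisfies both conditions is counted
twice. -/
noncomputable def inv {n : ℕ} (σ : SignedPerm n) : ℕ :=
  (Finset.univ.filter (fun p : PM n × PM n =>
    0 < p.1.1 ∧ p.1 < p.2 ∧ σ.1 p.2 < σ.1 p.1)).card +
  (Finset.univ.filter (fun p : PM n × PM n =>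
    0 < p.1.1 ∧ p.1 ≤ p.2 ∧ σ.1 p.2 < σ.1 (-p.1))).card

end SignedPerm

/-! ### Shifted diagrams and permutation tableaux of type `B`

A `(k, n)`-diagram (`0 ≤ k ≤ n`) is recorded by the set `C ⊆ [n]` of its `n - k` column labels,
i.e. by the set of horizontal steps of its southeast border, whose steps are numbered `1, …, n` from
the northeast corner to the southwest corner. The labels of the rows and columns serve as
coordinates: row labels increase from top to bottom, and column labels decrease from left to
right. -/

/-- `r` is the label of a row of the shifted diagram with column labels `C`: either `r ∈ [n]` labels
a row of the `(k, n)`-subdiagram, or `r = -i` where `i` labels a column (the row of the staircase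
whose diagonal lies in column `i`). -/
def IsRowLabel (n : ℕ) (C : Finset ℤ) (r : ℤ) : Prop :=
  (1 ≤ r ∧ r ≤ n ∧ r ∉ C) ∨ -r ∈ C

/-- Row `r` and column `c` of the shifted diagram meet in a box. For `r > 0` this says that the
border step `r` comes before the border step `c`; for `r = -i` it says that column `c` is column
`i` or lies to the left of it. -/
def IsBox (n : ℕ) (C : Finset ℤ) (r c : ℤ) : Prop :=
  IsRowLabel n C r ∧ c ∈ C ∧ |r| ≤ c

/-- Permutation tableaux of type `B` of length `n`. The `(0,1)`-filling is given by the set `ones` of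
the boxes that are filled with `1`; all other boxes are filled with `0`. -/
@[ext] structure PermTableauB (n : ℕ) where
  /-- The column labels. -/
  cols : Finset ℤ
  cols_subset : cols ⊆ Finset.Icc 1 (n : ℤ)
  /-- The boxes (row label, column label) filled with `1`. -/
  ones : Finset (ℤ × ℤ)
  ones_isBox : ∀ r c, (r, c) ∈ ones → IsBox n cols r c
  /-- Every column has at least one `1`. -/
  exists_one : ∀ c ∈ cols, ∃ r, (r, c) ∈ ones
  /-- A box with a `1` above it in its column and a `1` to the left in its row has a `1`. -/
  hinge : ∀ r c r' c', IsBox n cols r c → r' < r → (r', c) ∈ ones → c < c' → (r, c') ∈ ones →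
    (r, c) ∈ ones
  /-- If a diagonal has a `0`, then there is no `1` in its row. -/
  diag : ∀ i ∈ cols, (-i, i) ∉ ones → ∀ c, (-i, c) ∉ ones

/-! ### Zigzag paths -/

/-- The two directions of travel of a zigzag path. -/
inductive Dir : Type
  | east
  | south

/-- A position on a zigzag path: the path enters the place `(row, col)` in the direction `dir`. -/
@[ext] structure ZState where
  dir : Dir
  row : ℤ
  col : ℤ

namespace PermTableauB

variable {n : ℕ}

/-- One step of a zigzag path: it changes the direction at a `1` and goes straight on otherwise.
Places `(r, c)` that are not boxes carry no `1` and are crossed in a straight line. -/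
def step (T : PermTableauB n) : ZState → ZState
  | ⟨.east, r, c⟩ => if (r, c) ∈ T.ones then ⟨.south, r + 1, c⟩ else ⟨.east, r, c - 1⟩
  | ⟨.south, r, c⟩ => if (r, c) ∈ T.ones then ⟨.east, r, c - 1⟩ else ⟨.south, r + 1, c⟩

/-- The zigzag path from row `r` starts at the left of this row, moving east. -/
def rowStart (n : ℕ) (r : ℤ) : ZState := ⟨.east, r, n⟩

/-- The zigzag path from column `c` starts at the top of this column, moving south. -/
def colStart (n : ℕ) (c : ℤ) : ZState := ⟨.south, -n, c⟩

/-- The label of the row or column at which the path starting in the position `s` ends. All boxes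
`(r, c)` have `r < c`. So a path that leaves the diagram at the right end of row `p`, or at the
bottom of column `p`, then goes straight on, and reaches the line `r = c` at the place `(p, p)`.
Each step decreases `c - r` by one. -/
def endLabel (T : PermTableauB n) (s : ZState) : ℤ :=
  ((T.step)^[(s.col - s.row).toNat] s).row

/-- The position at which the path that determines `ζ(T)(±i)` starts, `i ∈ [n]`: row `i` if it
exists, and otherwise column `i` or row `-i` according as row `-i` has `0` or `1` in its diagonal. -/
def zetaStart (T : PermTableauB n) (i : ℤ) : ZState :=
  if i ∉ T.cols then rowStart n i
  else if (-i, i) ∉ T.ones then colStart n i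
  else rowStart n (-i)

/-- The value `ζ(T)(i)` for `i ∈ [n]`. -/
def zetaPos (T : PermTableauB n) (i : ℤ) : ℤ :=
  if i ∉ T.cols then T.endLabel (rowStart n i)
  else if (-i, i) ∉ T.ones then T.endLabel (colStart n i)
  else -T.endLabel (rowStart n (-i))

/-- The map `ζ(T)` on integers, extended from `[n]` by `ζ(T)(-i) = -ζ(T)(i)`. -/
def zetaFun (T : PermTableauB n) (x : ℤ) : ℤ :=
  if 0 < x then T.zetaPos x else -T.zetaPos (-x)

/-! The following facts show that `zetaFun` is a signed permutation. -/

theorem step_injective (T : PermTableauB n) : Function.Injective T.step := by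
  rintro ⟨d, r, c⟩ ⟨d', r', c'⟩ h
  cases d <;> cases d' <;> simp only [step] at h <;> split_ifs at h <;>
    simp only [ZState.mk.injEq, reduceCtorEq, true_and, false_and] at h <;>
    obtain ⟨h1, h2⟩ := h
  · simp_all
  · simp_all
  · obtain rfl : r = r' := by omega
    obtain rfl : c = c' := by omega
    contradiction
  · obtain rfl : r = r' := by omega
    obtain rfl : c = c' := by omega
    contradiction
  · obtain rfl : r = r' := by omega
    obtain rfl : c = c' := by omega
    contradiction
  · obtain rfl : r = r' := by omega
    obtain rfl : c = c' := by omega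
    contradiction
  · simp_all
  · simp_all

/-- What holds along the paths that are used by `ζ`. -/
def Good (T : PermTableauB n) (s : ZState) : Prop :=
  -(n : ℤ) ≤ s.row ∧ s.col ≤ n ∧
  match s.dir with
  | .east => IsRowLabel n T.cols s.row ∧ (s.row < 0 → -s.row ≤ s.col ∧ (s.row, -s.row) ∈ T.ones)
  | .south => s.col ∈ T.cols ∧ (s.row ≤ -s.col → (-s.col, s.col) ∉ T.ones)

theorem good_step (T : PermTableauB n) (s : ZState) (h : T.Good s) : T.Good (T.step s) := by
  obtain ⟨d, r, c⟩ := s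
  obtain ⟨h1, h2, h3⟩ := h
  cases d <;> simp only [step] at * <;> split_ifs with h4
  · obtain ⟨h5, h6, h7⟩ := T.ones_isBox _ _ h4
    refine ⟨by simp only; omega, h2, h6, fun h8 => ?_⟩
    simp only at h8
    have := neg_abs_le r
    omega
  · refine ⟨h1, by simp only; omega, h3.1, fun h8 => ?_⟩
    obtain ⟨h9, h10⟩ := h3.2 h8
    refine ⟨?_, h10⟩
    simp only
    by_contra h11
    obtain rfl : c = -r := by omega
    exact h4 h10
  · obtain ⟨h5, h6, h7⟩ := T.ones_isBox _ _ h4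
    refine ⟨h1, by simp only; omega, h5, fun h8 => ?_⟩
    simp only at h8 ⊢
    have h9 : (r, -r) ∈ T.ones := by
      by_contra h10
      rcases h5 with h5 | h5
      · omega
      · exact T.diag (-r) h5 (by simpa using h10) c (by simpa using h4)
    refine ⟨?_, h9⟩
    rw [abs_of_neg h8] at h7
    by_contra h10
    obtain rfl : c = -r := by omega
    exact h3.2 (by omega) (by simpa using h9)
  · refine ⟨by simp only; omega, h2, h3.1, fun h8 => h3.2 ?_⟩
    simp only at h8 ⊢
    omega

theorem good_iterate (T : PermTableauB n) (s : ZState) (h : T.Good s) (k : ℕ) :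
    T.Good ((T.step)^[k] s) := by
  induction k with
  | zero => exact h
  | succ k ih => rw [Function.iterate_succ_apply']; exact T.good_step _ ih

theorem step_diff (T : PermTableauB n) (s : ZState) :
    (T.step s).col - (T.step s).row = s.col - s.row - 1 := by
  obtain ⟨d, r, c⟩ := s
  cases d <;> simp only [step] <;> split_ifs <;> simp only <;> omega

theorem iterate_diff (T : PermTableauB n) (s : ZState) (k : ℕ) :
    ((T.step)^[k] s).col - ((T.step)^[k] s).row = s.col - s.row - k := by
  induction k with
  | zero => simp
  | succ k ih => rw [Function.iterate_succ_apply', step_diff, ih]; push_cast; ring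

theorem good_zetaStart (T : PermTableauB n) (i : ℤ) (h1 : 1 ≤ i) (h2 : i ≤ n) :
    T.Good (T.zetaStart i) := by
  unfold zetaStart
  split_ifs with h3 h4
  · refine ⟨by simp only [rowStart]; omega, le_refl _, Or.inr ?_, fun _ => ?_⟩
    · simpa [rowStart] using h3
    · simpa [rowStart] using ⟨h2, h4⟩
  · exact ⟨le_refl _, h2, h3, fun _ => h4⟩
  · refine ⟨by simp only [rowStart]; omega, le_refl _, Or.inl ⟨h1, h2, h3⟩, fun h5 => ?_⟩
    simp only [rowStart] at h5
    omega

theorem zetaStart_diff_nonneg (T : PermTableauB n) (i : ℤ) (h1 : 1 ≤ i) (h2 : i ≤ n) :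
    0 ≤ (T.zetaStart i).col - (T.zetaStart i).row := by
  unfold zetaStart
  split_ifs <;> simp only [rowStart, colStart] <;> omega

theorem abs_zetaPos (T : PermTableauB n) (i : ℤ) :
    |T.zetaPos i| = |T.endLabel (T.zetaStart i)| := by
  unfold zetaPos zetaStart
  split_ifs <;> simp

/-- The last position of a path used by `ζ`. -/
theorem end_spec (T : PermTableauB n) (i : ℤ) (h1 : 1 ≤ i) (h2 : i ≤ n) :
    ∃ p : ℤ, T.endLabel (T.zetaStart i) = p ∧ 1 ≤ p ∧ p ≤ n ∧ ∃ k : ℕ,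
      (p ∈ T.cols → (T.step)^[k] (T.zetaStart i) = ⟨.south, p, p⟩) ∧
      (p ∉ T.cols → (T.step)^[k] (T.zetaStart i) = ⟨.east, p, p⟩) := by
  have hd := T.zetaStart_diff_nonneg i h1 h2
  have hg := T.good_iterate _ (T.good_zetaStart i h1 h2)
    ((T.zetaStart i).col - (T.zetaStart i).row).toNat
  have he := T.iterate_diff (T.zetaStart i) ((T.zetaStart i).col - (T.zetaStart i).row).toNat
  refine ⟨_, rfl, ?_⟩
  unfold endLabel
  generalize hk : ((T.zetaStart i).col - (T.zetaStart i).row).toNat = k at *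
  generalize hs : (T.step)^[k] (T.zetaStart i) = s at *
  obtain ⟨d, r, c⟩ := s
  simp only at he ⊢
  obtain rfl : c = r := by omega
  obtain ⟨g1, g2, g3⟩ := hg
  simp only at g1 g2
  cases d
  · obtain ⟨g3, g4⟩ := g3
    simp only at g3 g4
    have hc : 0 ≤ c := by
      by_contra h
      have := (g4 (by omega)).1
      omega
    have g5 : 1 ≤ c ∧ c ∉ T.cols := by
      rcases g3 with g3 | g3
      · exact ⟨g3.1, g3.2.2⟩
      · have := Finset.mem_Icc.1 (T.cols_subset g3)
        omega
    exact ⟨g5.1, g2, k, fun h => absurd h g5.2, fun _ => hs⟩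
  · have g4 := Finset.mem_Icc.1 (T.cols_subset g3.1)
    exact ⟨g4.1, g2, k, fun _ => hs, fun h => absurd g3.1 h⟩

theorem zetaStart_not_step (T : PermTableauB n) (i : ℤ) (s : ZState) (hs : T.Good s) :
    T.step s ≠ T.zetaStart i := by
  obtain ⟨d, r, c⟩ := s
  obtain ⟨h1, h2, -⟩ := hs
  simp only at h1 h2
  intro h
  unfold zetaStart at h
  cases d <;> simp only [step, rowStart, colStart] at h <;> split_ifs at h <;>
    simp only [ZState.mk.injEq, reduceCtorEq, true_and, false_and] at h <;> omega

theorem zetaStart_inj (T : PermTableauB n) (i j : ℤ) (hi : 1 ≤ i) (hj : 1 ≤ j)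
    (h : T.zetaStart i = T.zetaStart j) : i = j := by
  unfold zetaStart at h
  split_ifs at h <;> simp only [rowStart, colStart, ZState.mk.injEq, reduceCtorEq, true_and,
    false_and, and_true] at h <;> omega

theorem start_eq_of_iterate_eq (T : PermTableauB n) (i j : ℤ) (hi : T.Good (T.zetaStart i))
    (k l : ℕ) (hkl : l ≤ k)
    (h : (T.step)^[k] (T.zetaStart i) = (T.step)^[l] (T.zetaStart j)) :
    T.zetaStart i = T.zetaStart j := by
  obtain ⟨m, rfl⟩ := Nat.exists_eq_add_of_le hkl
  rw [Function.iterate_add_apply] at h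
  have h' := T.step_injective.iterate l h
  cases m with
  | zero => exact h'
  | succ m =>
    rw [Function.iterate_succ_apply'] at h'
    exact absurd h' (T.zetaStart_not_step j _ (T.good_iterate _ hi m))

theorem abs_zetaPos_inj (T : PermTableauB n) (i j : ℤ) (hi : 1 ≤ i) (hi' : i ≤ n) (hj : 1 ≤ j)
    (hj' : j ≤ n) (h : |T.zetaPos i| = |T.zetaPos j|) : i = j := by
  rw [abs_zetaPos, abs_zetaPos] at h
  obtain ⟨p, hp, hp1, -, k, hk1, hk2⟩ := T.end_spec i hi hi'
  obtain ⟨q, hq, hq1, -, l, hl1, hl2⟩ := T.end_spec j hj hj'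
  rw [hp, hq, abs_of_pos (by omega), abs_of_pos (by omega)] at h
  subst h
  have hh : (T.step)^[k] (T.zetaStart i) = (T.step)^[l] (T.zetaStart j) := by
    by_cases hc : p ∈ T.cols
    · rw [hk1 hc, hl1 hc]
    · rw [hk2 hc, hl2 hc]
  apply T.zetaStart_inj i j hi hj
  rcases le_total l k with hkl | hkl
  · exact T.start_eq_of_iterate_eq i j (T.good_zetaStart i hi hi') k l hkl hh
  · exact (T.start_eq_of_iterate_eq j i (T.good_zetaStart j hj hj') l k hkl hh.symm).symm

theorem abs_zetaPos_mem (T : PermTableauB n) (i : ℤ) (hi : 1 ≤ i) (hi' : i ≤ n) :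
    1 ≤ |T.zetaPos i| ∧ |T.zetaPos i| ≤ n := by
  rw [abs_zetaPos]
  obtain ⟨p, hp, hp1, hp2, -⟩ := T.end_spec i hi hi'
  rw [hp, abs_of_pos (by omega)]
  exact ⟨hp1, hp2⟩

/-- `ζ(T)` as a self-map of `[±n]`. -/
def zetaMap (T : PermTableauB n) (x : PM n) : PM n :=
  ⟨T.zetaFun x.1, by
    have hx := x.2
    unfold zetaFun
    split_ifs with h
    · have := T.abs_zetaPos_mem x.1 (by omega) (by omega)
      rcases abs_cases (T.zetaPos x.1) with h | h <;> omega
    · have := T.abs_zetaPos_mem (-x.1) (by omega) (by omega)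
      rcases abs_cases (T.zetaPos (-x.1)) with h | h <;> omega⟩

theorem zetaMap_neg (T : PermTableauB n) (x : PM n) : T.zetaMap (-x) = -T.zetaMap x := by
  apply Subtype.ext
  have hx := x.2
  simp only [zetaMap, PM.val_neg, zetaFun]
  split_ifs
  · omega
  · simp
  · simp
  · omega

theorem zetaMap_injective (T : PermTableauB n) : Function.Injective T.zetaMap := by
  intro x y h
  have hx := x.2
  have hy := y.2
  have h' : T.zetaFun x.1 = T.zetaFun y.1 := congrArg Subtype.val h
  apply Subtype.ext
  have key : ∀ i j : ℤ, 1 ≤ i → i ≤ n → 1 ≤ j → j ≤ n → T.zetaPos i ≠ -T.zetaPos j := by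
    intro i j hi hi' hj hj' hij
    have hij' : i = j := T.abs_zetaPos_inj i j hi hi' hj hj' (by rw [hij, abs_neg])
    subst hij'
    have := (T.abs_zetaPos_mem i hi hi').1
    have h0 : T.zetaPos i = 0 := by omega
    rw [h0] at this
    simp at this
  unfold zetaFun at h'
  split_ifs at h'
  · exact T.abs_zetaPos_inj _ _ (by omega) (by omega) (by omega) (by omega) (by rw [h'])
  · exact absurd h' (key _ _ (by omega) (by omega) (by omega) (by omega))
  · exact absurd h'.symm (key _ _ (by omega) (by omega) (by omega) (by omega))
  · have := T.abs_zetaPos_inj (-x.1) (-y.1) (by omega) (by omega) (by omega) (by omega)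
      (by rw [neg_injective h'])
    omega

/-- The zigzag map `ζ` from permutation tableaux of type `B` to signed permutations. -/
noncomputable def zeta (T : PermTableauB n) : SignedPerm n :=
  ⟨Equiv.ofBijective T.zetaMap (Finite.injective_iff_bijective.1 T.zetaMap_injective),
    fun x => T.zetaMap_neg x⟩

/-! ### Statistics on tableaux -/

/-- The zigzag path starting in the position `s` enters the place `(r, c)` in the direction `d`. -/
def Passes (T : PermTableauB n) (s : ZState) (d : Dir) (r c : ℤ) : Prop :=
  ∃ k : ℕ, (T.step)^[k] s = ⟨d, r, c⟩

/-- The zigzag path that passes `(r, c)` in the direction `d` comes from a row of `T`. -/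
def FromRow (T : PermTableauB n) (d : Dir) (r c : ℤ) : Prop :=
  ∃ j, IsRowLabel n T.cols j ∧ T.Passes (rowStart n j) d r c

/-- The zigzag path that passes `(r, c)` in the direction `d` comes from a column of `T`. -/
def FromCol (T : PermTableauB n) (d : Dir) (r c : ℤ) : Prop :=
  ∃ j, j ∈ T.cols ∧ T.Passes (colStart n j) d r c

/-- The box `(r, c)` is filled with `0`. -/
def IsZero (T : PermTableauB n) (r c : ℤ) : Prop :=
  IsBox n T.cols r c ∧ (r, c) ∉ T.ones

/-- The number of `0`s such that the two zigzag paths through it both come from rows. -/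
noncomputable def zeroEE (T : PermTableauB n) : ℕ :=
  {b : ℤ × ℤ | T.IsZero b.1 b.2 ∧ T.FromRow .east b.1 b.2 ∧ T.FromRow .south b.1 b.2}.ncard

/-- The number of `0`s such that the two zigzag paths through it both come from columns. -/
noncomputable def zeroNN (T : PermTableauB n) : ℕ :=
  {b : ℤ × ℤ | T.IsZero b.1 b.2 ∧ T.FromCol .east b.1 b.2 ∧ T.FromCol .south b.1 b.2}.ncard

/-- The number of `1`s. -/
def one (T : PermTableauB n) : ℕ := T.ones.card

end PermTableauB

/-!
Prolong all zigzag paths backwards to the line `col - row = 2 * n`, so that they become pipes of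
equal length. Two pipes that meet in a `1` touch, and two that meet in a `0` cross. Condition (2) on
the filling forces a `1` into each box where two pipes meet again, so they end in the order in which
they leave the box where they first meet. Hence a box holds a `1` if and only if the path that
enters it heading south ends before the one that enters it heading east, and two pipes cross, then
only once, exactly if their ends are not in the order of their starts.

So a tableau is determined by the ends of its paths. Conversely, if these are prescribed in
accordance with a signed permutation, the tableau is rebuilt from them column by column: of the two
paths that meet in a box, the one with the smaller prescribed end must leave to the east. Every box
is a one or a crossing, and the number of boxes and of crossings of each kind are compared with the
number of inversions for each pair of labels. Finally `ℓ = inv` because `sᵢ` permutes the positive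
roots other than its own simple root.
-/

/-! ### Length and inversions -/

namespace SignedPerm

variable {n : ℕ}

/-- A signed permutation as a permutation of the integers: it fixes `0` and all `z` with `n < |z|`,
so that its values on `0, …, n + 1` and their negatives need no side conditions. -/
noncomputable def toPerm : SignedPerm n →* Equiv.Perm ℤ :=
  Equiv.Perm.ofSubtype.comp (SignedPerm n).subtype

theorem toPerm_coe (σ : SignedPerm n) (x : PM n) : toPerm σ x = σ.1 x :=
  Equiv.Perm.ofSubtype_apply_coe σ.1 x

theorem toPerm_of_notMem (σ : SignedPerm n) {z : ℤ} (hz : ¬(z ≠ 0 ∧ -(n : ℤ) ≤ z ∧ z ≤ n)) :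
    toPerm σ z = z :=
  Equiv.Perm.ofSubtype_apply_of_not_mem σ.1 hz

theorem toPerm_zero (σ : SignedPerm n) : toPerm σ 0 = 0 :=
  toPerm_of_notMem σ (by simp)

theorem toPerm_neg (σ : SignedPerm n) (z : ℤ) : toPerm σ (-z) = -toPerm σ z := by
  by_cases hz : z ≠ 0 ∧ -(n : ℤ) ≤ z ∧ z ≤ n
  · have h := toPerm_coe σ (-⟨z, hz⟩)
    rwa [σ.2, PM.val_neg, PM.val_neg, ← toPerm_coe] at h
  · rw [toPerm_of_notMem σ hz, toPerm_of_notMem σ (by omega)]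

theorem toPerm_mem (σ : SignedPerm n) {z : ℤ} (hz : z ≠ 0 ∧ -(n : ℤ) ≤ z ∧ z ≤ n) :
    toPerm σ z ≠ 0 ∧ -(n : ℤ) ≤ toPerm σ z ∧ toPerm σ z ≤ n := by
  rw [toPerm_coe σ ⟨z, hz⟩]
  exact (σ.1 ⟨z, hz⟩).2

theorem toPerm_injective : Function.Injective (toPerm (n := n)) :=
  Equiv.Perm.ofSubtype_injective.comp Subtype.val_injective

theorem ext_toPerm {σ τ : SignedPerm n} (h : ∀ z : ℤ, 1 ≤ z → z ≤ n → toPerm σ z = toPerm τ z) :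
    σ = τ := by
  refine toPerm_injective (Equiv.ext fun z => ?_)
  by_cases hz : z ≠ 0 ∧ -(n : ℤ) ≤ z ∧ z ≤ n
  · rcases lt_or_gt_of_ne hz.1 with hneg | hpos
    · rw [← neg_inj, ← toPerm_neg, ← toPerm_neg]
      exact h _ (by omega) (by omega)
    · exact h z hpos hz.2.2
  · rw [toPerm_of_notMem σ hz, toPerm_of_notMem τ hz]

theorem card_filter_pos (Q : ℤ → ℤ → Prop) [∀ i j, Decidable (Q i j)] :
    (Finset.univ.filter fun p : PM n × PM n => 0 < p.1.1 ∧ 0 < p.2.1 ∧ Q p.1 p.2).card =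
      ((Finset.Icc 1 (n : ℤ) ×ˢ Finset.Icc 1 (n : ℤ)).filter fun p => Q p.1 p.2).card := by
  refine Finset.card_bij (fun p _ => (p.1.1, p.2.1)) ?_ ?_ ?_
  · intro p hp
    have hp₁ := p.1.2
    have hp₂ := p.2.2
    simp only [Finset.mem_filter, Finset.mem_univ, true_and, Finset.mem_product,
      Finset.mem_Icc] at hp ⊢
    exact ⟨by omega, hp.2.2⟩
  · intro p _ q _ h
    exact Prod.ext (Subtype.ext (Prod.ext_iff.1 h).1) (Subtype.ext (Prod.ext_iff.1 h).2)
  · rintro ⟨i, j⟩ h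
    simp only [Finset.mem_filter, Finset.mem_product, Finset.mem_Icc] at h
    refine ⟨(⟨i, by omega⟩, ⟨j, by omega⟩), ?_, rfl⟩
    simp only [Finset.mem_filter, Finset.mem_univ, true_and]
    exact ⟨by omega, by omega, h.2⟩

theorem inv_eq_card (σ : SignedPerm n) :
    inv σ = ((Finset.Icc 1 (n : ℤ) ×ˢ Finset.Icc 1 (n : ℤ)).filter fun p =>
        p.1 < p.2 ∧ toPerm σ p.2 < toPerm σ p.1).card +
      ((Finset.Icc 1 (n : ℤ) ×ˢ Finset.Icc 1 (n : ℤ)).filter fun p =>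
        p.1 ≤ p.2 ∧ toPerm σ p.2 < -toPerm σ p.1).card := by
  rw [inv, ← card_filter_pos fun i j => i < j ∧ toPerm σ j < toPerm σ i,
    ← card_filter_pos fun i j => i ≤ j ∧ toPerm σ j < -toPerm σ i]
  congr 2 <;> ext p
  · simp only [Finset.mem_filter, Finset.mem_univ, true_and, ← Subtype.coe_lt_coe, toPerm_coe]
    exact and_congr_right fun h => ⟨fun h' => ⟨h.trans h'.1, h'⟩, And.right⟩
  · have hneg : σ.1 (-p.1) = -σ.1 p.1 := σ.2 p.1
    simp only [Finset.mem_filter, Finset.mem_univ, true_and, ← Subtype.coe_lt_coe,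
      ← Subtype.coe_le_coe, hneg, PM.val_neg, toPerm_coe]
    exact and_congr_right fun h => ⟨fun h' => ⟨h.trans_le h'.1, h'⟩, And.right⟩

theorem inv_eq_sum (σ : SignedPerm n) :
    (inv σ : ℤ) = ∑ i ∈ Finset.Icc 1 (n : ℤ), ∑ j ∈ Finset.Icc 1 (n : ℤ),
      ((if i < j ∧ toPerm σ j < toPerm σ i then 1 else 0) +
        if i ≤ j ∧ toPerm σ j < -toPerm σ i then 1 else 0) := by
  simp only [inv_eq_card, Nat.cast_add, Finset.natCast_card_filter, Finset.sum_product,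
    Finset.sum_add_distrib]

theorem simpleFun_neg (i : ℕ) (z : ℤ) : simpleFun i (-z) = -simpleFun i z := by
  unfold simpleFun
  split_ifs <;> omega

theorem simpleFun_involutive (i : ℕ) : Function.Involutive (simpleFun i) := by
  intro x
  unfold simpleFun
  split_ifs <;> omega

theorem toPerm_simple (i : Fin n) (z : ℤ) : toPerm (simple i) z = simpleFun (i : ℕ) z := by
  by_cases hz : z ≠ 0 ∧ -(n : ℤ) ≤ z ∧ z ≤ n
  · exact toPerm_coe (simple i) ⟨z, hz⟩
  · rw [toPerm_of_notMem _ hz, simpleFun]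
    have hi := i.2
    split_ifs <;> omega

theorem toPerm_mul_simple (σ : SignedPerm n) (i : Fin n) (z : ℤ) :
    toPerm (σ * simple i) z = toPerm σ (simpleFun (i : ℕ) z) := by
  rw [map_mul, Equiv.Perm.mul_apply, toPerm_simple]

theorem simple_mul_self (i : Fin n) : simple i * simple i = 1 :=
  Subtype.ext (Equiv.ext (simpleMap_involutive i))

/-- The positive roots of type `Bₙ`. The pair `(x, y)` with `x ≠ 0` stands for the root `e_y - e_x`,
where `e_{-x} = -e_x`, and `(0, y)` for the root `e_y`. -/
noncomputable def posRoots (n : ℕ) : Finset (ℤ × ℤ) :=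
  (Finset.Icc (-(n : ℤ)) n ×ˢ Finset.Icc 1 (n : ℤ)).filter fun p => -p.2 < p.1 ∧ p.1 < p.2

theorem mem_posRoots {p : ℤ × ℤ} : p ∈ posRoots n ↔ p.2 ≤ n ∧ -p.2 < p.1 ∧ p.1 < p.2 := by
  simp only [posRoots, Finset.mem_filter, Finset.mem_product, Finset.mem_Icc]
  omega

/-- The positive roots that `σ` sends to negative roots. -/
noncomputable def invRoots (σ : SignedPerm n) : Finset (ℤ × ℤ) :=
  (posRoots n).filter fun p => toPerm σ p.2 < toPerm σ p.1

theorem card_invRoots_pos (σ : SignedPerm n) :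
    ((invRoots σ).filter fun p => 0 < p.1).card =
      ((Finset.Icc 1 (n : ℤ) ×ˢ Finset.Icc 1 (n : ℤ)).filter fun p =>
        p.1 < p.2 ∧ toPerm σ p.2 < toPerm σ p.1).card := by
  congr 1
  ext p
  simp only [invRoots, Finset.mem_filter, mem_posRoots, Finset.mem_product, Finset.mem_Icc]
  omega

theorem card_invRoots_nonpos (σ : SignedPerm n) :
    ((invRoots σ).filter fun p => ¬0 < p.1).card =
      ((Finset.Icc 1 (n : ℤ) ×ˢ Finset.Icc 1 (n : ℤ)).filter fun p =>
        p.1 ≤ p.2 ∧ toPerm σ p.2 < -toPerm σ p.1).card := by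
  refine Finset.card_nbij' (fun p => (if p.1 = 0 then p.2 else -p.1, p.2))
    (fun p => (if p.1 = p.2 then 0 else -p.1, p.2)) ?_ ?_ ?_ ?_ <;> rintro ⟨x, y⟩ h <;>
    simp only [invRoots, Finset.coe_filter, Set.mem_ofPred_eq, Finset.mem_filter, mem_posRoots,
      Finset.mem_product, Finset.mem_Icc, Prod.mk.injEq, and_true] at h ⊢
  · split_ifs with hx
    · rw [hx, toPerm_zero] at h
      omega
    · rw [toPerm_neg]
      omega
  · split_ifs with hxy
    · rw [hxy] at h
      rw [toPerm_zero]
      omega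
    · rw [toPerm_neg]
      omega
  · split_ifs <;> omega
  · split_ifs <;> omega

theorem card_invRoots (σ : SignedPerm n) : (invRoots σ).card = inv σ := by
  rw [← Finset.card_filter_add_card_filter_not (fun p => 0 < p.1), card_invRoots_pos,
    card_invRoots_nonpos, inv_eq_card]

/-- The `i`th simple root, `e₁` for `i = 0` and `e_{i + 1} - e_i` for `i ≥ 1`. -/
def simpleRoot (i : ℕ) : ℤ × ℤ := (i, i + 1)

theorem simpleFun_self (i : ℕ) :
    simpleFun i i = if i = 0 then 0 else (i : ℤ) + 1 := by
  unfold simpleFun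
  split_ifs <;> omega

theorem simpleFun_succ (i : ℕ) :
    simpleFun i (i + 1) = if i = 0 then -1 else (i : ℤ) := by
  unfold simpleFun
  split_ifs <;> omega

theorem simpleRoot_mem_invRoots {σ : SignedPerm n} {i : Fin n} :
    simpleRoot i ∈ invRoots σ ↔ toPerm σ ((i : ℕ) + 1) < toPerm σ (i : ℕ) := by
  have hi := i.2
  simp only [simpleRoot, invRoots, Finset.mem_filter, mem_posRoots, and_iff_right_iff_imp]
  omega

theorem simpleRoot_mem_invRoots_mul_simple {σ : SignedPerm n} {i : Fin n} :
    simpleRoot i ∈ invRoots (σ * simple i) ↔ simpleRoot i ∉ invRoots σ := by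
  have hne : toPerm σ ((i : ℕ) + 1) ≠ toPerm σ (i : ℕ) := by simp
  rw [simpleRoot_mem_invRoots, simpleRoot_mem_invRoots, toPerm_mul_simple, toPerm_mul_simple,
    simpleFun_self, simpleFun_succ]
  split_ifs with hi
  · rw [hi, Nat.cast_zero, zero_add, toPerm_zero] at hne ⊢
    rw [toPerm_neg]
    omega
  · omega

/-- The root `sᵢ p` up to sign: the sign is the one that makes it positive. -/
def reflectRoot (i : ℕ) (p : ℤ × ℤ) : ℤ × ℤ :=
  if -simpleFun i p.2 < simpleFun i p.1 then (simpleFun i p.1, simpleFun i p.2)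
  else (-simpleFun i p.2, -simpleFun i p.1)

theorem reflectRoot_mem {i : ℕ} (hi : i < n) {p : ℤ × ℤ}
    (hp : p ∈ (posRoots n).erase (simpleRoot i)) :
    reflectRoot i p ∈ (posRoots n).erase (simpleRoot i) := by
  obtain ⟨x, y⟩ := p
  simp only [Finset.mem_erase, mem_posRoots, simpleRoot, reflectRoot, simpleFun, ne_eq] at hp ⊢
  split_ifs <;> grind

theorem reflectRoot_reflectRoot (i : ℕ) {p : ℤ × ℤ} (hp : p ∈ posRoots n) :
    reflectRoot i (reflectRoot i p) = p := by
  rw [mem_posRoots] at hp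
  by_cases h : -simpleFun i p.2 < simpleFun i p.1
  · simp only [reflectRoot, if_pos h, simpleFun_involutive i _, if_pos hp.2.1]
  · simp only [reflectRoot, if_neg h, simpleFun_neg, simpleFun_involutive i _]
    rw [if_neg (by omega), neg_neg, neg_neg]

theorem toPerm_reflectRoot_lt (σ : SignedPerm n) (i : Fin n) (p : ℤ × ℤ) :
    toPerm σ (reflectRoot i p).2 < toPerm σ (reflectRoot i p).1 ↔
      toPerm (σ * simple i) p.2 < toPerm (σ * simple i) p.1 := by
  simp only [toPerm_mul_simple, reflectRoot]
  split_ifs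
  · rfl
  · rw [toPerm_neg, toPerm_neg, neg_lt_neg_iff]

theorem reflectRoot_mem_invRoots {σ : SignedPerm n} {i : Fin n} {p : ℤ × ℤ}
    (hp : p ∈ (invRoots (σ * simple i)).erase (simpleRoot i)) :
    reflectRoot i p ∈ (invRoots σ).erase (simpleRoot i) := by
  rw [invRoots, ← Finset.filter_erase, Finset.mem_filter] at hp ⊢
  exact ⟨reflectRoot_mem i.2 hp.1, (toPerm_reflectRoot_lt σ i p).2 hp.2⟩

theorem card_erase_invRoots_mul_simple (σ : SignedPerm n) (i : Fin n) :
    ((invRoots (σ * simple i)).erase (simpleRoot i)).card =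
      ((invRoots σ).erase (simpleRoot i)).card := by
  have involutive {τ : SignedPerm n} {p} (hp : p ∈ (invRoots τ).erase (simpleRoot i)) :
      reflectRoot i (reflectRoot i p) = p :=
    reflectRoot_reflectRoot i (Finset.mem_filter.1 (Finset.mem_of_mem_erase hp)).1
  refine Finset.card_bij' (fun p _ => reflectRoot i p) (fun p _ => reflectRoot i p)
    (fun _ => reflectRoot_mem_invRoots) (fun p hp => reflectRoot_mem_invRoots ?_)
    (fun _ => involutive) (fun _ => involutive)
  rwa [mul_assoc, simple_mul_self, mul_one]

theorem inv_mul_simple_of_mem {σ : SignedPerm n} {i : Fin n} (h : simpleRoot i ∈ invRoots σ) :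
    inv (σ * simple i) + 1 = inv σ := by
  have h' : simpleRoot i ∉ invRoots (σ * simple i) := fun h' =>
    simpleRoot_mem_invRoots_mul_simple.1 h' h
  rw [← card_invRoots, ← card_invRoots, ← Finset.card_erase_add_one h,
    ← card_erase_invRoots_mul_simple, Finset.erase_eq_of_notMem h']

theorem inv_mul_simple_le (σ : SignedPerm n) (i : Fin n) : inv (σ * simple i) ≤ inv σ + 1 := by
  by_cases h : simpleRoot i ∈ invRoots σ
  · have := inv_mul_simple_of_mem h
    omega
  · have := inv_mul_simple_of_mem (simpleRoot_mem_invRoots_mul_simple.2 h)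
    rw [mul_assoc, simple_mul_self, mul_one] at this
    omega

theorem inv_one : inv (1 : SignedPerm n) = 0 := by
  rw [← card_invRoots, Finset.card_eq_zero, invRoots, Finset.filter_eq_empty_iff]
  intro p hp
  rw [map_one, Equiv.Perm.one_apply, Equiv.Perm.one_apply]
  exact (mem_posRoots.1 hp).2.2.not_gt

theorem inv_prod_le (w : List (Fin n)) : inv (w.map simple).prod ≤ w.length := by
  induction w using List.reverseRecOn with
  | nil => simp [inv_one]
  | append_singleton w i ih =>
    rw [List.map_append, List.prod_append, List.map_singleton, List.prod_singleton,
      List.length_append, List.length_singleton]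
    exact (inv_mul_simple_le _ i).trans (Nat.add_le_add_right ih 1)

theorem strictMono_toPerm {σ : SignedPerm n} (h : ∀ i : Fin n, simpleRoot i ∉ invRoots σ) :
    StrictMono (toPerm σ) := by
  have step_nonneg {z : ℤ} (hz : 0 ≤ z) : toPerm σ z < toPerm σ (z + 1) := by
    rcases lt_trichotomy z n with hzn | rfl | hzn
    · have hz' := h ⟨z.toNat, by omega⟩
      rw [simpleRoot_mem_invRoots] at hz'
      simp only [Int.toNat_of_nonneg hz] at hz'
      exact lt_of_le_of_ne (not_lt.1 hz') (by simp)
    · rw [toPerm_of_notMem σ (z := n + 1) (by omega)]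
      by_cases hn : (n : ℤ) = 0
      · rw [hn, toPerm_zero, zero_add]
        exact one_pos
      · have := toPerm_mem σ (z := n) (by omega)
        omega
    · rw [toPerm_of_notMem σ (z := z) (by omega), toPerm_of_notMem σ (by omega)]
      omega
  refine strictMono_int_of_lt_succ fun z => ?_
  rcases le_or_gt 0 z with hz | hz
  · exact step_nonneg hz
  · have := step_nonneg (z := -(z + 1)) (by omega)
    rwa [toPerm_neg, show -(z + 1) + 1 = -z by ring, toPerm_neg, neg_lt_neg_iff] at this

theorem eq_one_of_forall_notMem {σ : SignedPerm n} (h : ∀ i : Fin n, simpleRoot i ∉ invRoots σ) :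
    σ = 1 := by
  have hmono : StrictMono σ.1 := fun x y hxy => by
    rw [← Subtype.coe_lt_coe, ← toPerm_coe, ← toPerm_coe]
    exact strictMono_toPerm h hxy
  exact Subtype.ext (Equiv.ext (congrFun hmono.eq_id))

theorem exists_word (σ : SignedPerm n) :
    ∃ w : List (Fin n), w.length = inv σ ∧ (w.map simple).prod = σ := by
  induction hm : inv σ generalizing σ with
  | zero =>
    refine ⟨[], rfl, (eq_one_of_forall_notMem fun i hi => ?_).symm⟩
    have := inv_mul_simple_of_mem hi
    omega
  | succ m ih =>
    obtain ⟨i, hi⟩ : ∃ i : Fin n, simpleRoot i ∈ invRoots σ := by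
      by_contra! h
      rw [eq_one_of_forall_notMem h, inv_one] at hm
      omega
    have hinv := inv_mul_simple_of_mem hi
    obtain ⟨w, hlength, hprod⟩ := ih (σ * simple i) (by omega)
    exact ⟨w ++ [i], by simp [hlength], by simp [hprod, mul_assoc, simple_mul_self]⟩

theorem length_eq_inv (σ : SignedPerm n) : length σ = inv σ := by
  refine le_antisymm (Nat.sInf_le (exists_word σ)) (le_csInf ⟨_, exists_word σ⟩ ?_)
  rintro k ⟨w, rfl, rfl⟩
  exact inv_prod_le w

end SignedPerm

/-! ### Zigzag paths as pipes -/

/-- The rank of a position among the positions with the same value of `col - row`, counted from the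
northeast. At each place the position heading south precedes the one heading east. -/
def ZState.rank (s : ZState) : ℤ :=
  match s.dir with
  | .east => 2 * s.col + 1
  | .south => 2 * s.col

namespace ZState

theorem eq_of_rank_eq {x y : ZState} (hd : x.col - x.row = y.col - y.row)
    (h : x.rank = y.rank) : x = y := by
  obtain ⟨d, r, c⟩ := x
  obtain ⟨d', r', c'⟩ := y
  cases d <;> cases d' <;> simp only [rank] at h hd ⊢ <;>
    simp only [ZState.mk.injEq, true_and, reduceCtorEq, false_and] <;> omega

theorem eq_south_east {x y : ZState} (hd : x.col - x.row = y.col - y.row)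
    (h : x.rank < y.rank) (hc : x.col = y.col) :
    ∃ r c, x = ⟨.south, r, c⟩ ∧ y = ⟨.east, r, c⟩ := by
  obtain ⟨d, r, c⟩ := x
  obtain ⟨d', r', c'⟩ := y
  obtain rfl : c = c' := hc
  obtain rfl : r = r' := by simp only at hd; omega
  cases d <;> cases d' <;> simp only [rank] at h
  · omega
  · omega
  · exact ⟨r, c, rfl, rfl⟩
  · omega

end ZState

namespace PermTableauB

variable {n : ℕ}

theorem mem_cols_bounds (T : PermTableauB n) {c : ℤ} (hc : c ∈ T.cols) : 1 ≤ c ∧ c ≤ n :=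
  Finset.mem_Icc.1 (T.cols_subset hc)

theorem isRowLabel_bounds (T : PermTableauB n) {r : ℤ} (hr : IsRowLabel n T.cols r) :
    -(n : ℤ) ≤ r ∧ r ≤ n ∧ r ≠ 0 := by
  rcases hr with hr | hr
  · omega
  · have := T.mem_cols_bounds hr
    omega

theorem notMem_cols_of_isRowLabel (T : PermTableauB n) {r : ℤ} (hr : IsRowLabel n T.cols r) :
    r ∉ T.cols := by
  rcases hr with hr | hr
  · exact hr.2.2
  · intro hr'
    have := T.mem_cols_bounds hr
    have := T.mem_cols_bounds hr'
    omega

theorem isBox_iff (T : PermTableauB n) {r c : ℤ} :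
    IsBox n T.cols r c ↔ IsRowLabel n T.cols r ∧ c ∈ T.cols ∧ -c ≤ r ∧ r < c := by
  refine and_congr_right fun hr => and_congr_right fun hc => ?_
  have : r ≠ c := fun h => T.notMem_cols_of_isRowLabel hr (h ▸ hc)
  rw [abs_le]
  omega

theorem ones_spec (T : PermTableauB n) {r c : ℤ} (h : (r, c) ∈ T.ones) :
    IsRowLabel n T.cols r ∧ c ∈ T.cols ∧ -c ≤ r ∧ r < c :=
  T.isBox_iff.1 (T.ones_isBox r c h)

theorem mem_ones_of_hinge (T : PermTableauB n) {r c r' c' : ℤ} (habove : (r', c) ∈ T.ones)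
    (hr : r' < r) (hleft : (r, c') ∈ T.ones) (hc : c < c') (hrc : r < c) : (r, c) ∈ T.ones := by
  obtain ⟨-, hcol, hlow, -⟩ := T.ones_spec habove
  exact T.hinge r c r' c' (T.isBox_iff.2 ⟨(T.ones_spec hleft).1, hcol, by omega, hrc⟩) hr habove
    hc hleft

theorem step_of_mem (T : PermTableauB n) {r c : ℤ} (h : (r, c) ∈ T.ones) :
    T.step ⟨.east, r, c⟩ = ⟨.south, r + 1, c⟩ ∧ T.step ⟨.south, r, c⟩ = ⟨.east, r, c - 1⟩ :=
  ⟨if_pos h, if_pos h⟩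

theorem step_of_notMem (T : PermTableauB n) {r c : ℤ} (h : (r, c) ∉ T.ones) :
    T.step ⟨.east, r, c⟩ = ⟨.east, r, c - 1⟩ ∧ T.step ⟨.south, r, c⟩ = ⟨.south, r + 1, c⟩ :=
  ⟨if_neg h, if_neg h⟩

theorem diff_of_iterate_eq (T : PermTableauB n) {s : ZState} {k : ℕ} {d : Dir} {r c : ℤ}
    (h : T.step^[k] s = ⟨d, r, c⟩) : c - r = s.col - s.row - k := by
  rw [← T.iterate_diff s k, h]

/-- A path travels east only along rows of the diagram, and south only along columns. -/
def Valid (T : PermTableauB n) (s : ZState) : Prop :=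
  match s.dir with
  | .east => IsRowLabel n T.cols s.row
  | .south => s.col ∈ T.cols

theorem valid_step (T : PermTableauB n) {s : ZState} (hs : T.Valid s) : T.Valid (T.step s) := by
  obtain ⟨d, r, c⟩ := s
  cases d <;> simp only [step] <;> split_ifs with h
  · exact (T.ones_spec h).2.1
  · exact hs
  · exact (T.ones_spec h).1
  · exact hs

theorem valid_iterate (T : PermTableauB n) {s : ZState} (hs : T.Valid s) (k : ℕ) :
    T.Valid (T.step^[k] s) := by
  induction k with
  | zero => exact hs
  | succ k ih =>
    rw [Function.iterate_succ_apply']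
    exact T.valid_step ih

theorem endLabel_of_col_eq_row (T : PermTableauB n) {s : ZState} (h : s.col = s.row) :
    T.endLabel s = s.row := by
  simp [endLabel, h]

theorem endLabel_step (T : PermTableauB n) {s : ZState} (h : s.row < s.col) :
    T.endLabel (T.step s) = T.endLabel s := by
  unfold endLabel
  rw [step_diff, ← Function.iterate_succ_apply]
  congr 2
  omega

theorem endLabel_iterate (T : PermTableauB n) {s : ZState} {k : ℕ}
    (hk : (k : ℤ) ≤ s.col - s.row) : T.endLabel (T.step^[k] s) = T.endLabel s := by
  induction k with
  | zero => rfl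
  | succ k ih =>
    have := T.iterate_diff s k
    rw [Function.iterate_succ_apply', endLabel_step T (by omega), ih (by omega)]

theorem endLabel_of_iterate_eq (T : PermTableauB n) {s : ZState} {k : ℕ} {d : Dir} {r c : ℤ}
    (h : T.step^[k] s = ⟨d, r, c⟩) (hrc : r ≤ c) : T.endLabel ⟨d, r, c⟩ = T.endLabel s := by
  have := T.diff_of_iterate_eq h
  rw [← h, T.endLabel_iterate (by omega)]

theorem rank_step_lt (T : PermTableauB n) {x y : ZState} (hd : x.col - x.row = y.col - y.row)
    (hrank : x.rank < y.rank)
    (hone : ∀ r c, x = ⟨.south, r, c⟩ → y = ⟨.east, r, c⟩ → (r, c) ∈ T.ones) :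
    (T.step x).rank < (T.step y).rank := by
  by_cases hc : x.col = y.col
  · obtain ⟨r, c, rfl, rfl⟩ := ZState.eq_south_east hd hrank hc
    rw [(T.step_of_mem (hone r c rfl rfl)).1, (T.step_of_mem (hone r c rfl rfl)).2]
    simp only [ZState.rank]
    omega
  · obtain ⟨d, r, c⟩ := x
    obtain ⟨d', r', c'⟩ := y
    cases d <;> cases d' <;> simp only [ZState.rank, step] at hrank hc ⊢ <;> split_ifs <;>
      simp only <;> omega

theorem rank_iterate_lt (T : PermTableauB n) {x y : ZState} (hd : x.col - x.row = y.col - y.row)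
    (hrank : x.rank < y.rank) {k : ℕ}
    (hone : ∀ j < k, (T.step^[j] x).rank < (T.step^[j] y).rank → ∀ r c,
      T.step^[j] x = ⟨.south, r, c⟩ → T.step^[j] y = ⟨.east, r, c⟩ → (r, c) ∈ T.ones) :
    (T.step^[k] x).rank < (T.step^[k] y).rank := by
  induction k with
  | zero => exact hrank
  | succ k ih =>
    have hk := ih fun j hj => hone j (hj.trans k.lt_succ_self)
    rw [Function.iterate_succ_apply', Function.iterate_succ_apply']
    exact T.rank_step_lt (by rw [iterate_diff, iterate_diff, hd]) hk (hone k k.lt_succ_self hk)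

theorem row_lt_of_rank_lt (T : PermTableauB n) {x y : ZState} (hx : T.Valid x) (hy : T.Valid y)
    (hrank : x.rank < y.rank) (hx' : x.col = x.row) (hy' : y.col = y.row) : x.row < y.row := by
  obtain ⟨d, r, c⟩ := x
  obtain ⟨d', r', c'⟩ := y
  obtain rfl : c = r := hx'
  obtain rfl : c' = r' := hy'
  cases d <;> cases d' <;> simp only [ZState.rank, Valid] at hrank hx hy ⊢
  · omega
  · omega
  · refine lt_of_le_of_ne (by omega) ?_
    rintro rfl
    exact T.notMem_cols_of_isRowLabel hy hx
  · omega

theorem endLabel_lt_of_rank_iterate_lt (T : PermTableauB n) {x y : ZState} (hx : T.Valid x)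
    (hy : T.Valid y) (hd : x.col - x.row = y.col - y.row) {k : ℕ} (hk : x.col - x.row = k)
    (h : (T.step^[k] x).rank < (T.step^[k] y).rank) : T.endLabel x < T.endLabel y := by
  have hxk := T.iterate_diff x k
  have hyk := T.iterate_diff y k
  rw [← T.endLabel_iterate hk.ge, ← T.endLabel_iterate (hk.ge.trans_eq hd),
    T.endLabel_of_col_eq_row (by omega), T.endLabel_of_col_eq_row (by omega)]
  exact T.row_lt_of_rank_lt (T.valid_iterate hx k) (T.valid_iterate hy k) h (by omega) (by omega)

/-- The path `x` runs northeast of the path `y`, and the hinge condition forces a `1` into each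
place where they meet. -/
def Separated (T : PermTableauB n) (x y : ZState) : Prop :=
  x.rank < y.rank ∧
  (x.dir = .south → ∃ r < x.row, (r, x.col) ∈ T.ones) ∧
  (y.dir = .east → ∃ c > y.col, (y.row, c) ∈ T.ones)

theorem Separated.mem_ones {T : PermTableauB n} {r c : ℤ}
    (h : T.Separated ⟨.south, r, c⟩ ⟨.east, r, c⟩) (hrc : r < c) : (r, c) ∈ T.ones := by
  obtain ⟨-, habove, hleft⟩ := h
  obtain ⟨r', hr', hones⟩ := habove rfl
  obtain ⟨c', hc', hones'⟩ := hleft rfl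
  exact T.mem_ones_of_hinge hones hr' hones' hc' hrc

theorem Separated.step {T : PermTableauB n} {x y : ZState} (h : T.Separated x y)
    (hd : x.col - x.row = y.col - y.row) (hx : x.row < x.col) :
    T.Separated (T.step x) (T.step y) := by
  refine ⟨T.rank_step_lt hd h.1 ?_, ?_, ?_⟩
  · rintro r c rfl rfl
    exact h.mem_ones hx
  · obtain ⟨d, r, c⟩ := x
    cases d <;> simp only [PermTableauB.step] <;> split_ifs with hrc
    · exact fun _ => ⟨r, lt_add_one r, hrc⟩
    · simp
    · simp
    · obtain ⟨r', hr', hones⟩ := h.2.1 rfl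
      exact fun _ => ⟨r', hr'.trans (lt_add_one r), hones⟩
  · obtain ⟨d, r, c⟩ := y
    cases d <;> simp only [PermTableauB.step] <;> split_ifs with hrc
    · simp
    · obtain ⟨c', hc', hones⟩ := h.2.2 rfl
      exact fun _ => ⟨c', (sub_one_lt c).trans hc', hones⟩
    · exact fun _ => ⟨c, sub_one_lt c, hrc⟩
    · simp

theorem Separated.iterate {T : PermTableauB n} {x y : ZState} (h : T.Separated x y)
    (hd : x.col - x.row = y.col - y.row) {k : ℕ} (hk : (k : ℤ) ≤ x.col - x.row) :
    T.Separated (T.step^[k] x) (T.step^[k] y) := by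
  induction k with
  | zero => exact h
  | succ k ih =>
    have hxk := T.iterate_diff x k
    have hyk := T.iterate_diff y k
    rw [Function.iterate_succ_apply', Function.iterate_succ_apply']
    exact (ih (by omega)).step (by omega) (by omega)

theorem Separated.endLabel_lt {T : PermTableauB n} {x y : ZState} (h : T.Separated x y)
    (hx : T.Valid x) (hy : T.Valid y) (hd : x.col - x.row = y.col - y.row)
    (hxd : x.row ≤ x.col) : T.endLabel x < T.endLabel y :=
  T.endLabel_lt_of_rank_iterate_lt hx hy hd (k := (x.col - x.row).toNat) (by omega)
    (h.iterate hd (by omega)).1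

theorem endLabel_lt_of_mem_ones (T : PermTableauB n) {r c : ℤ} (h : (r, c) ∈ T.ones) :
    T.endLabel ⟨.south, r, c⟩ < T.endLabel ⟨.east, r, c⟩ := by
  obtain ⟨hr, hc, -, hrc⟩ := T.ones_spec h
  rw [← T.endLabel_step (s := ⟨.south, r, c⟩) hrc, ← T.endLabel_step (s := ⟨.east, r, c⟩) hrc,
    (T.step_of_mem h).1, (T.step_of_mem h).2]
  refine Separated.endLabel_lt ⟨?_, by simp, by simp⟩ hr hc ?_ ?_ <;> simp only [ZState.rank] <;>
    omega

theorem endLabel_lt_of_notMem_ones (T : PermTableauB n) {r c : ℤ} (hr : IsRowLabel n T.cols r)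
    (hc : c ∈ T.cols) (hrc : r < c) (h : (r, c) ∉ T.ones) :
    T.endLabel ⟨.east, r, c⟩ < T.endLabel ⟨.south, r, c⟩ := by
  rw [← T.endLabel_step (s := ⟨.south, r, c⟩) hrc, ← T.endLabel_step (s := ⟨.east, r, c⟩) hrc,
    (T.step_of_notMem h).1, (T.step_of_notMem h).2]
  refine Separated.endLabel_lt ⟨?_, by simp, by simp⟩ hr hc ?_ ?_ <;> simp only [ZState.rank] <;>
    omega

theorem mem_ones_iff (T : PermTableauB n) {r c : ℤ} (hr : IsRowLabel n T.cols r)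
    (hc : c ∈ T.cols) (hrc : r < c) :
    (r, c) ∈ T.ones ↔ T.endLabel ⟨.south, r, c⟩ < T.endLabel ⟨.east, r, c⟩ := by
  refine ⟨T.endLabel_lt_of_mem_ones, fun h => ?_⟩
  by_contra hzero
  exact lt_asymm h (T.endLabel_lt_of_notMem_ones hr hc hrc hzero)

theorem rank_iterate_lt_of_endLabel_lt (T : PermTableauB n) {x y : ZState} (hx : T.Valid x)
    (hy : T.Valid y) (hd : x.col - x.row = y.col - y.row) (hrank : x.rank < y.rank)
    (hend : T.endLabel x < T.endLabel y) {k : ℕ} (hk : (k : ℤ) ≤ x.col - x.row) :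
    (T.step^[k] x).rank < (T.step^[k] y).rank := by
  refine T.rank_iterate_lt hd hrank fun j hj _ r c hxj hyj => ?_
  have hdiff := T.diff_of_iterate_eq hxj
  have hrc : r < c := by omega
  have hc := T.valid_iterate hx j
  have hr := T.valid_iterate hy j
  rw [hxj] at hc
  rw [hyj] at hr
  rwa [T.mem_ones_iff hr hc hrc, T.endLabel_of_iterate_eq hxj hrc.le,
    T.endLabel_of_iterate_eq hyj hrc.le]

/-- The paths from `x` and `y` cross in a `0` at the place `(r, c)`, where `x` heads south and `y`
heads east. -/
def Cross (T : PermTableauB n) (x y : ZState) (r c : ℤ) : Prop :=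
  r < c ∧ (r, c) ∉ T.ones ∧ ∃ k : ℕ, T.step^[k] x = ⟨.south, r, c⟩ ∧ T.step^[k] y = ⟨.east, r, c⟩

theorem exists_cross (T : PermTableauB n) {x y : ZState} (hx : T.Valid x) (hy : T.Valid y)
    (hd : x.col - x.row = y.col - y.row) (hxd : x.row ≤ x.col) (hrank : x.rank < y.rank)
    (hend : T.endLabel y < T.endLabel x) : ∃ r c, T.Cross x y r c := by
  by_contra! hcross
  have hk : ((x.col - x.row).toNat : ℤ) = x.col - x.row := by omega
  refine hend.not_gt (T.endLabel_lt_of_rank_iterate_lt hx hy hd hk.symm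
    (T.rank_iterate_lt hd hrank fun j hj _ r c hxj hyj => ?_))
  have hrc := T.diff_of_iterate_eq hxj
  by_contra hzero
  exact hcross r c ⟨by omega, hzero, j, hxj, hyj⟩

theorem Cross.endLabel_lt {T : PermTableauB n} {x y : ZState} {r c : ℤ} (hx : T.Valid x)
    (hy : T.Valid y) (h : T.Cross x y r c) : T.endLabel y < T.endLabel x := by
  obtain ⟨hrc, hzero, k, hxk, hyk⟩ := h
  have hc := T.valid_iterate hx k
  have hr := T.valid_iterate hy k
  rw [hxk] at hc
  rw [hyk] at hr
  rw [← T.endLabel_of_iterate_eq hxk hrc.le, ← T.endLabel_of_iterate_eq hyk hrc.le]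
  exact T.endLabel_lt_of_notMem_ones hr hc hrc hzero

theorem Cross.rank_lt {T : PermTableauB n} {x y : ZState} {r c : ℤ} (hx : T.Valid x)
    (hy : T.Valid y) (hd : x.col - x.row = y.col - y.row) (hxy : x ≠ y)
    (h : T.Cross x y r c) : x.rank < y.rank := by
  by_contra! hle
  have hrank : y.rank < x.rank := hle.lt_of_ne fun heq => hxy (ZState.eq_of_rank_eq hd heq.symm)
  have hend := h.endLabel_lt hx hy
  obtain ⟨hrc, -, k, hxk, hyk⟩ := h
  have hk := T.diff_of_iterate_eq hyk
  have := T.rank_iterate_lt_of_endLabel_lt hy hx hd.symm hrank hend (k := k) (by omega)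
  rw [hxk, hyk] at this
  simp only [ZState.rank] at this
  omega

theorem rank_iterate_lt_of_cross (T : PermTableauB n) {x y : ZState} (hx : T.Valid x)
    (hy : T.Valid y) {r c : ℤ} {k m : ℕ} (hxk : T.step^[k] x = ⟨.south, r, c⟩)
    (hyk : T.step^[k] y = ⟨.east, r, c⟩) (hzero : (r, c) ∉ T.ones) (hkm : k < m)
    (hm : (m : ℤ) ≤ x.col - x.row) : (T.step^[m] y).rank < (T.step^[m] x).rank := by
  obtain ⟨l, rfl⟩ := Nat.exists_eq_add_of_lt hkm
  have hdiff := T.diff_of_iterate_eq hxk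
  have hrc : r < c := by omega
  have hc := T.valid_iterate hx k
  have hr := T.valid_iterate hy k
  rw [hxk] at hc
  rw [hyk] at hr
  rw [show k + l + 1 = l + 1 + k by ring, Function.iterate_add_apply _ _ _ x,
    Function.iterate_add_apply _ _ _ y, hxk, hyk, Function.iterate_succ_apply,
    Function.iterate_succ_apply]
  have hend := T.endLabel_lt_of_notMem_ones hr hc hrc hzero
  rw [← T.endLabel_step (s := ⟨.south, r, c⟩) hrc,
    ← T.endLabel_step (s := ⟨.east, r, c⟩) hrc] at hend
  refine T.rank_iterate_lt_of_endLabel_lt (T.valid_step hr) (T.valid_step hc)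
    (by simp only [step_diff]) ?_ hend (by simp only [step_diff]; omega)
  rw [(T.step_of_notMem hzero).1, (T.step_of_notMem hzero).2]
  simp only [ZState.rank]
  omega

theorem Cross.unique {T : PermTableauB n} {x y : ZState} {r c r' c' : ℤ} (hx : T.Valid x)
    (hy : T.Valid y) (h : T.Cross x y r c) (h' : T.Cross x y r' c') : r = r' ∧ c = c' := by
  obtain ⟨hrc, hzero, k, hxk, hyk⟩ := h
  obtain ⟨hrc', hzero', k', hxk', hyk'⟩ := h'
  have not_before {r c r' c' : ℤ} {k k' : ℕ} (hxk : T.step^[k] x = ⟨.south, r, c⟩)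
      (hyk : T.step^[k] y = ⟨.east, r, c⟩) (hzero : (r, c) ∉ T.ones) (hrc' : r' < c')
      (hxk' : T.step^[k'] x = ⟨.south, r', c'⟩) (hyk' : T.step^[k'] y = ⟨.east, r', c'⟩) :
      ¬k < k' := fun hlt => by
    have hk' := T.diff_of_iterate_eq hxk'
    have := T.rank_iterate_lt_of_cross hx hy hxk hyk hzero hlt (by omega)
    rw [hxk', hyk'] at this
    simp only [ZState.rank] at this
    omega
  obtain rfl : k = k' := le_antisymm
    (not_lt.1 (not_before hxk' hyk' hzero' hrc hxk hyk))
    (not_lt.1 (not_before hxk hyk hzero hrc' hxk' hyk'))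
  rw [hxk] at hxk'
  simpa using hxk'

end PermTableauB

/-! ### Counting the crossings -/

namespace PermTableauB

variable {n : ℕ}

/-- The path from a row (`d = east`) or column (`d = south`) with label `j`, prolonged backwards to
the line `col - row = 2 * n`. All paths then have the same number of steps. -/
def start (n : ℕ) (d : Dir) (j : ℤ) : ZState :=
  match d with
  | .east => ⟨.east, j, j + 2 * n⟩
  | .south => ⟨.south, j - 2 * n, j⟩

/-- `j` is the label of a row (`d = east`) or column (`d = south`). -/
def IsLabel (T : PermTableauB n) (d : Dir) (j : ℤ) : Prop :=
  match d with
  | .east => IsRowLabel n T.cols j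
  | .south => j ∈ T.cols

theorem valid_start (T : PermTableauB n) {d : Dir} {j : ℤ} (h : T.IsLabel d j) :
    T.Valid (start n d j) := by
  cases d <;> exact h

theorem start_diff (d : Dir) (j : ℤ) : (start n d j).col - (start n d j).row = 2 * n := by
  cases d <;> simp [start]

theorem start_row_le_col (d : Dir) (j : ℤ) : (start n d j).row ≤ (start n d j).col := by
  have := start_diff (n := n) d j
  omega

theorem start_injective {d d' : Dir} {j j' : ℤ} (h : start n d j = start n d' j') :
    d = d' ∧ j = j' := by
  cases d <;> cases d' <;> simp_all [start]

theorem length_of_iterate_start_eq (T : PermTableauB n) {d d' : Dir} {j r c : ℤ} {k : ℕ}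
    (h : T.step^[k] (start n d j) = ⟨d', r, c⟩) : (k : ℤ) = 2 * n - (c - r) := by
  have := T.diff_of_iterate_eq h
  rw [start_diff] at this
  omega

theorem start_eq_of_iterate_start_eq (T : PermTableauB n) {d e d' : Dir} {i j r c : ℤ} {k l : ℕ}
    (hi : T.step^[k] (start n d i) = ⟨d', r, c⟩) (hj : T.step^[l] (start n e j) = ⟨d', r, c⟩) :
    d = e ∧ i = j := by
  have hk := T.length_of_iterate_start_eq hi
  have hl := T.length_of_iterate_start_eq hj
  obtain rfl : k = l := by omega
  exact start_injective (T.step_injective.iterate k (hi.trans hj.symm))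

theorem iterate_east (T : PermTableauB n) {r c : ℤ} {k : ℕ}
    (h : ∀ m : ℕ, m < k → (r, c - m) ∉ T.ones) :
    T.step^[k] ⟨.east, r, c⟩ = ⟨.east, r, c - k⟩ := by
  induction k with
  | zero => simp
  | succ k ih =>
    rw [Function.iterate_succ_apply', ih fun m hm => h m (by omega),
      (T.step_of_notMem (h k (by omega))).1]
    push_cast
    rw [sub_sub]

theorem iterate_south (T : PermTableauB n) {r c : ℤ} {k : ℕ}
    (h : ∀ m : ℕ, m < k → (r + m, c) ∉ T.ones) :
    T.step^[k] ⟨.south, r, c⟩ = ⟨.south, r + k, c⟩ := by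
  induction k with
  | zero => simp
  | succ k ih =>
    rw [Function.iterate_succ_apply', ih fun m hm => h m (by omega),
      (T.step_of_notMem (h k (by omega))).2]
    push_cast
    rw [add_assoc]

theorem iterate_start_east (T : PermTableauB n) {j : ℤ} {k : ℕ} (hk : (k : ℤ) ≤ n + j) :
    T.step^[k] (start n .east j) = ⟨.east, j, j + 2 * n - k⟩ :=
  T.iterate_east fun m hm h => by
    have := T.mem_cols_bounds (T.ones_spec h).2.1
    omega

theorem iterate_start_south (T : PermTableauB n) {j : ℤ} {k : ℕ} (hk : (k : ℤ) ≤ 2 * n - 2 * j) :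
    T.step^[k] (start n .south j) = ⟨.south, j - 2 * n + k, j⟩ :=
  T.iterate_south fun m hm h => by
    have := (T.ones_spec h).2.2.1
    omega

theorem iterate_start_eq_rowStart (T : PermTableauB n) {j : ℤ} (hj : -(n : ℤ) ≤ j) :
    T.step^[(n + j).toNat] (start n .east j) = rowStart n j := by
  rw [T.iterate_start_east (by omega)]
  simp only [rowStart, ZState.mk.injEq, true_and]
  omega

theorem iterate_start_eq_colStart (T : PermTableauB n) {j : ℤ} (hj : j ≤ n) :
    T.step^[(n - j).toNat] (start n .south j) = colStart n j := by
  rw [T.iterate_start_south (by omega)]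
  simp only [colStart, ZState.mk.injEq, true_and, and_true]
  omega

theorem endLabel_start_east (T : PermTableauB n) {j : ℤ} (hj : -(n : ℤ) ≤ j) (hj' : j ≤ n) :
    T.endLabel (start n .east j) = T.endLabel (rowStart n j) := by
  rw [← T.iterate_start_eq_rowStart hj, T.endLabel_iterate (by rw [start_diff]; omega)]

theorem endLabel_start_south (T : PermTableauB n) {j : ℤ} (hj : 0 ≤ j) (hj' : j ≤ n) :
    T.endLabel (start n .south j) = T.endLabel (colStart n j) := by
  rw [← T.iterate_start_eq_colStart hj', T.endLabel_iterate (by rw [start_diff]; omega)]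

/-- The path that enters `(r, c)` in the direction `d'` comes from a row (`d = east`) or from a
column (`d = south`). -/
def From (T : PermTableauB n) (d d' : Dir) (r c : ℤ) : Prop :=
  ∃ j, T.IsLabel d j ∧ ∃ k : ℕ, T.step^[k] (start n d j) = ⟨d', r, c⟩

theorem From.unique {T : PermTableauB n} {d e d' : Dir} {r c : ℤ} (h : T.From d d' r c)
    (h' : T.From e d' r c) : d = e := by
  obtain ⟨i, -, k, hi⟩ := h
  obtain ⟨j, -, l, hj⟩ := h'
  exact (T.start_eq_of_iterate_start_eq hi hj).1

theorem fromRow_iff (T : PermTableauB n) (d : Dir) {r c : ℤ} (hc : c ≤ n) :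
    T.FromRow d r c ↔ T.From .east d r c := by
  constructor
  · rintro ⟨j, hj, k, hk⟩
    refine ⟨j, hj, k + (n + j).toNat, ?_⟩
    rw [Function.iterate_add_apply, T.iterate_start_eq_rowStart (T.isRowLabel_bounds hj).1, hk]
  · rintro ⟨j, hj, k, hk⟩
    have hjn := (T.isRowLabel_bounds hj).1
    refine ⟨j, hj, k - (n + j).toNat, ?_⟩
    rw [← T.iterate_start_eq_rowStart hjn, ← Function.iterate_add_apply, Nat.sub_add_cancel, hk]
    by_contra hlt
    rw [T.iterate_start_east (by omega)] at hk
    simp only [ZState.mk.injEq] at hk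
    omega

theorem fromCol_iff (T : PermTableauB n) (d : Dir) {r c : ℤ} (hr : -(n : ℤ) ≤ r) :
    T.FromCol d r c ↔ T.From .south d r c := by
  constructor
  · rintro ⟨j, hj, k, hk⟩
    refine ⟨j, hj, k + (n - j).toNat, ?_⟩
    rw [Function.iterate_add_apply, T.iterate_start_eq_colStart (T.mem_cols_bounds hj).2, hk]
  · rintro ⟨j, hj, k, hk⟩
    have hjn := T.mem_cols_bounds hj
    refine ⟨j, hj, k - (n - j).toNat, ?_⟩
    rw [← T.iterate_start_eq_colStart hjn.2, ← Function.iterate_add_apply, Nat.sub_add_cancel, hk]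
    by_contra hlt
    rw [T.iterate_start_south (by omega)] at hk
    simp only [ZState.mk.injEq] at hk
    omega

theorem exists_step_eq (T : PermTableauB n) {s : ZState} (h : T.Valid s) :
    ∃ s', T.Valid s' ∧ T.step s' = s := by
  obtain ⟨d, r, c⟩ := s
  cases d
  · by_cases hone : (r, c + 1) ∈ T.ones
    · exact ⟨⟨.south, r, c + 1⟩, (T.ones_spec hone).2.1, by simp [step, hone]⟩
    · exact ⟨⟨.east, r, c + 1⟩, h, by simp [step, hone]⟩
  · by_cases hone : (r - 1, c) ∈ T.ones
    · exact ⟨⟨.east, r - 1, c⟩, (T.ones_spec hone).1, by simp [step, hone]⟩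
    · exact ⟨⟨.south, r - 1, c⟩, h, by simp [step, hone]⟩

theorem exists_start (T : PermTableauB n) {s : ZState} (h : T.Valid s)
    (hs : s.col - s.row ≤ 2 * n) :
    ∃ d j, T.IsLabel d j ∧ ∃ k : ℕ, T.step^[k] (start n d j) = s := by
  obtain ⟨m, hm⟩ : ∃ m : ℕ, s.col - s.row = 2 * n - m :=
    ⟨(2 * n - (s.col - s.row)).toNat, by omega⟩
  induction m generalizing s with
  | zero =>
    obtain ⟨d, r, c⟩ := s
    simp only at hm
    cases d
    · exact ⟨.east, r, h, 0, by simp [start]; omega⟩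
    · exact ⟨.south, c, h, 0, by simp [start]; omega⟩
  | succ m ih =>
    obtain ⟨s', hs', rfl⟩ := T.exists_step_eq h
    rw [step_diff] at hm
    obtain ⟨d, j, hj, k, hk⟩ := ih hs' (by omega) (by omega)
    exact ⟨d, j, hj, k + 1, by rw [Function.iterate_succ_apply', hk]⟩

theorem iterate_col_le (T : PermTableauB n) (s : ZState) (k : ℕ) :
    (T.step^[k] s).col ≤ s.col := by
  induction k with
  | zero => rfl
  | succ k ih =>
    rw [Function.iterate_succ_apply']
    refine le_trans ?_ ih
    obtain ⟨d, r, c⟩ := T.step^[k] s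
    cases d <;> simp only [step] <;> split_ifs <;> simp

theorem le_iterate_row (T : PermTableauB n) (s : ZState) (k : ℕ) :
    s.row ≤ (T.step^[k] s).row := by
  induction k with
  | zero => rfl
  | succ k ih =>
    rw [Function.iterate_succ_apply']
    refine le_trans ih ?_
    obtain ⟨d, r, c⟩ := T.step^[k] s
    cases d <;> simp only [step] <;> split_ifs <;> simp

theorem row_le_endLabel (T : PermTableauB n) (s : ZState) : s.row ≤ T.endLabel s :=
  T.le_iterate_row s _

theorem endLabel_le_col (T : PermTableauB n) {s : ZState} (h : s.row ≤ s.col) :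
    T.endLabel s ≤ s.col := by
  have hcol := T.iterate_col_le s (s.col - s.row).toNat
  have hdiff := T.iterate_diff s (s.col - s.row).toNat
  unfold endLabel
  omega

theorem endLabel_east_of_lt_neg (T : PermTableauB n) {r c : ℤ} (h : r < -c) :
    T.endLabel ⟨.east, r, c⟩ = r := by
  unfold endLabel
  rw [T.iterate_east]
  intro m _ hone
  have := (T.ones_spec hone).2.2.1
  omega

theorem eq_of_iterate_start_eq_south (T : PermTableauB n) {d : Dir} {j r c : ℤ} {k : ℕ}
    (h : r < -c) (hk : T.step^[k] (start n d j) = ⟨.south, r, c⟩) : d = .south ∧ j = c := by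
  have hlen := T.length_of_iterate_start_eq hk
  refine T.start_eq_of_iterate_start_eq hk (l := k) ?_
  rw [T.iterate_start_south (by omega), hlen]
  congr 1
  ring

theorem Cross.isBox_iff {T : PermTableauB n} {d d' : Dir} {i j r c : ℤ} (hi : T.IsLabel d i)
    (hj : T.IsLabel d' j) (h : T.Cross (start n d i) (start n d' j) r c) :
    IsBox n T.cols r c ↔ (d = .south → -i ≤ T.endLabel (start n d' j)) := by
  obtain ⟨hrc, -, k, hik, hjk⟩ := h
  have hr := T.valid_iterate (T.valid_start hj) k
  have hc := T.valid_iterate (T.valid_start hi) k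
  rw [hjk] at hr
  rw [hik] at hc
  rw [T.isBox_iff, ← T.endLabel_of_iterate_eq hjk hrc.le]
  constructor
  · rintro ⟨-, -, hlow, -⟩ rfl
    have hrow := T.row_le_endLabel ⟨.east, r, c⟩
    have hcol := T.iterate_col_le (start n .south i) k
    rw [hik] at hcol
    simp only [start] at hrow hcol
    omega
  · intro hend
    refine ⟨hr, hc, ?_, hrc⟩
    by_contra! hlt
    obtain ⟨rfl, rfl⟩ := T.eq_of_iterate_start_eq_south hlt hik
    have := hend rfl
    rw [T.endLabel_east_of_lt_neg hlt] at this
    omega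

/-- The `0`s that are crossed south by a path of kind `d`, and east by a path of kind `d'`. -/
def zeros (T : PermTableauB n) (d d' : Dir) : Set (ℤ × ℤ) :=
  {b | T.IsZero b.1 b.2 ∧ T.From d .south b.1 b.2 ∧ T.From d' .east b.1 b.2}

/-- The pairs of paths of kinds `d` and `d'` which cross in a box of the diagram. The last condition
excludes the crossings to the left of the staircase. -/
def crossings (T : PermTableauB n) (d d' : Dir) : Set (ℤ × ℤ) :=
  {p | T.IsLabel d p.1 ∧ T.IsLabel d' p.2 ∧ (start n d p.1).rank < (start n d' p.2).rank ∧
    T.endLabel (start n d' p.2) < T.endLabel (start n d p.1) ∧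
    (d = .south → -p.1 ≤ T.endLabel (start n d' p.2))}

theorem exists_cross_of_mem_crossings (T : PermTableauB n) {d d' : Dir} {i j : ℤ}
    (h : (i, j) ∈ T.crossings d d') :
    ∃ b ∈ T.zeros d d', T.Cross (start n d i) (start n d' j) b.1 b.2 := by
  obtain ⟨hi, hj, hrank, hend, hbox⟩ := h
  obtain ⟨r, c, hcross⟩ := T.exists_cross (T.valid_start hi) (T.valid_start hj)
    (by rw [start_diff, start_diff]) (start_row_le_col d i) hrank hend
  exact ⟨(r, c), ⟨⟨(hcross.isBox_iff hi hj).2 hbox, hcross.2.1⟩,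
    ⟨i, hi, hcross.2.2.imp fun _ => And.left⟩, ⟨j, hj, hcross.2.2.imp fun _ => And.right⟩⟩, hcross⟩

theorem exists_cross_of_mem_zeros (T : PermTableauB n) {d d' : Dir} {r c : ℤ}
    (h : (r, c) ∈ T.zeros d d') :
    ∃ p ∈ T.crossings d d', T.Cross (start n d p.1) (start n d' p.2) r c := by
  obtain ⟨⟨hbox, hzero⟩, ⟨i, hi, k, hik⟩, ⟨j, hj, l, hjl⟩⟩ := h
  have hk := T.length_of_iterate_start_eq hik
  have hl := T.length_of_iterate_start_eq hjl
  obtain rfl : k = l := by omega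
  have hcross : T.Cross (start n d i) (start n d' j) r c :=
    ⟨(T.isBox_iff.1 hbox).2.2.2, hzero, k, hik, hjl⟩
  have hne : start n d i ≠ start n d' j := fun heq => by
    rw [heq, hjl] at hik
    simp at hik
  exact ⟨(i, j), ⟨hi, hj,
    hcross.rank_lt (T.valid_start hi) (T.valid_start hj) (by rw [start_diff, start_diff]) hne,
    hcross.endLabel_lt (T.valid_start hi) (T.valid_start hj), (hcross.isBox_iff hi hj).1 hbox⟩,
    hcross⟩

theorem ncard_crossings (T : PermTableauB n) (d d' : Dir) :
    (T.crossings d d').ncard = (T.zeros d d').ncard := by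
  choose! f hmem hf using fun p (hp : p ∈ T.crossings d d') => T.exists_cross_of_mem_crossings hp
  refine Set.ncard_congr (fun p _ => f p) hmem ?_ ?_
  · rintro p q hp hq heq
    obtain ⟨-, -, k, hpS, hpE⟩ := hf p hp
    obtain ⟨-, -, l, hqS, hqE⟩ := hf q hq
    rw [heq] at hpS hpE
    exact Prod.ext (T.start_eq_of_iterate_start_eq hpS hqS).2
      (T.start_eq_of_iterate_start_eq hpE hqE).2
  · rintro ⟨r, c⟩ hrc
    obtain ⟨p, hp, hcross⟩ := T.exists_cross_of_mem_zeros hrc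
    obtain ⟨hr, hc⟩ := (hf p hp).unique (T.valid_start hp.1) (T.valid_start hp.2.1) hcross
    exact ⟨p, hp, Prod.ext hr hc⟩

/-- The set of all boxes. -/
def boxes (T : PermTableauB n) : Set (ℤ × ℤ) := {b | IsBox n T.cols b.1 b.2}

theorem finite_boxes (T : PermTableauB n) : T.boxes.Finite := by
  refine (Set.finite_Icc (-(n : ℤ), -(n : ℤ)) (n, n)).subset ?_
  rintro ⟨r, c⟩ ⟨hr, hc, -⟩
  have := T.isRowLabel_bounds hr
  have := T.mem_cols_bounds hc
  simp only [Set.mem_Icc, Prod.mk_le_mk]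
  omega

theorem finite_zeros (T : PermTableauB n) (d d' : Dir) : (T.zeros d d').Finite :=
  T.finite_boxes.subset fun _ hb => hb.1.1

theorem zeroEE_eq (T : PermTableauB n) : T.zeroEE = (T.crossings .east .east).ncard := by
  rw [ncard_crossings, zeroEE]
  congr 1
  ext ⟨r, c⟩
  refine and_congr_right fun h => ?_
  have hc := (T.mem_cols_bounds h.1.2.1).2
  rw [T.fromRow_iff _ hc, T.fromRow_iff _ hc, and_comm]

theorem zeroNN_eq (T : PermTableauB n) : T.zeroNN = (T.crossings .south .south).ncard := by
  rw [ncard_crossings, zeroNN]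
  congr 1
  ext ⟨r, c⟩
  refine and_congr_right fun h => ?_
  have hr := (T.isRowLabel_bounds h.1.1).1
  rw [T.fromCol_iff _ hr, T.fromCol_iff _ hr, and_comm]

theorem zeros_east_south (T : PermTableauB n) : T.zeros .east .south = ∅ := by
  refine Set.eq_empty_of_forall_notMem fun b hb => ?_
  obtain ⟨⟨i, j⟩, ⟨hi, hj, hrank, -⟩, -⟩ := T.exists_cross_of_mem_zeros hb
  have := T.isRowLabel_bounds hi
  have := T.mem_cols_bounds hj
  simp only [start, ZState.rank] at hrank
  omega

theorem disjoint_zeros (T : PermTableauB n) {d d' e e' : Dir} (h : (d, d') ≠ (e, e')) :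
    Disjoint (T.zeros d d') (T.zeros e e') :=
  Set.disjoint_left.2 fun _ hb hb' =>
    h (Prod.ext (hb.2.1.unique hb'.2.1) (hb.2.2.unique hb'.2.2))

theorem disjoint_ones_zeros (T : PermTableauB n) (d d' : Dir) :
    Disjoint (T.ones : Set (ℤ × ℤ)) (T.zeros d d') :=
  Set.disjoint_left.2 fun _ hb hb' => hb'.1.2 hb

theorem exists_mem_zeros (T : PermTableauB n) {r c : ℤ} (hzero : T.IsZero r c) :
    ∃ d d', (r, c) ∈ T.zeros d d' := by
  obtain ⟨hr, hc, -⟩ := hzero.1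
  have := T.isRowLabel_bounds hr
  have := T.mem_cols_bounds hc
  obtain ⟨d, i, hi⟩ := T.exists_start (s := ⟨.south, r, c⟩) hc (by simp only; omega)
  obtain ⟨d', j, hj⟩ := T.exists_start (s := ⟨.east, r, c⟩) hr (by simp only; omega)
  exact ⟨d, d', hzero, ⟨i, hi⟩, ⟨j, hj⟩⟩

theorem boxes_eq (T : PermTableauB n) :
    T.boxes = ((T.ones : Set (ℤ × ℤ)) ∪ T.zeros .east .east ∪ T.zeros .south .south) ∪
      T.zeros .south .east := by
  ext ⟨r, c⟩
  simp only [Set.mem_union, Finset.mem_coe]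
  constructor
  · intro hbox
    by_cases hone : (r, c) ∈ T.ones
    · exact Or.inl (Or.inl (Or.inl hone))
    obtain ⟨d, d', hzero⟩ := T.exists_mem_zeros ⟨hbox, hone⟩
    cases d <;> cases d'
    · exact Or.inl (Or.inl (Or.inr hzero))
    · rw [zeros_east_south] at hzero
      exact hzero.elim
    · exact Or.inr hzero
    · exact Or.inl (Or.inr hzero)
  · rintro (((hone | hzero) | hzero) | hzero)
    · exact T.ones_isBox r c hone
    all_goals exact hzero.1.1

theorem ncard_boxes (T : PermTableauB n) :
    T.boxes.ncard = T.one + T.zeroEE + T.zeroNN + (T.crossings .south .east).ncard := by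
  have hfin := T.finite_zeros
  have hone := T.disjoint_ones_zeros
  rw [boxes_eq, Set.ncard_union_eq _ _ (hfin _ _), Set.ncard_union_eq _ _ (hfin _ _),
    Set.ncard_union_eq (hone _ _) T.ones.finite_toSet (hfin _ _), Set.ncard_coe_finset, zeroEE_eq,
    zeroNN_eq, ncard_crossings, ncard_crossings, ncard_crossings, one]
  · exact Set.disjoint_union_left.2 ⟨hone _ _, T.disjoint_zeros (by simp)⟩
  · exact T.ones.finite_toSet.union (hfin _ _)
  · exact Set.disjoint_union_left.2
      ⟨Set.disjoint_union_left.2 ⟨hone _ _, T.disjoint_zeros (by simp)⟩, T.disjoint_zeros (by simp)⟩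
  · exact (T.ones.finite_toSet.union (hfin _ _)).union (hfin _ _)

end PermTableauB

/-! ### Inversions and the statistics of tableaux -/

theorem sum_sum_eq_of_add_swap_eq {ι : Type*} (s : Finset ι) (F G : ι → ι → ℤ)
    (h : ∀ i ∈ s, ∀ j ∈ s, F i j + F j i = G i j + G j i) :
    ∑ i ∈ s, ∑ j ∈ s, F i j = ∑ i ∈ s, ∑ j ∈ s, G i j := by
  have hdouble (H : ι → ι → ℤ) :
      ∑ i ∈ s, ∑ j ∈ s, (H i j + H j i) = 2 * ∑ i ∈ s, ∑ j ∈ s, H i j := by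
    simp only [Finset.sum_add_distrib]
    rw [Finset.sum_comm (f := fun i j => H j i)]
    ring
  have hsum := Finset.sum_congr rfl fun i hi => Finset.sum_congr rfl fun j hj => h i hi j hj
  rw [hdouble, hdouble] at hsum
  linarith

namespace PermTableauB

variable {n : ℕ}

theorem toPerm_zeta (T : PermTableauB n) {i : ℤ} (hi : 1 ≤ i) (hi' : i ≤ n) :
    SignedPerm.toPerm T.zeta i = T.zetaPos i := by
  rw [SignedPerm.toPerm_coe T.zeta ⟨i, by omega⟩]
  exact if_pos (show (0 : ℤ) < i by omega)

/-- The label of the row (`d = east`) or column (`d = south`) that belongs to `i ∈ [n]`. If `i` is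
not a column label, then the value for `d = south` is a junk value. -/
def label (T : PermTableauB n) (d : Dir) (i : ℤ) : ℤ :=
  match d with
  | .east => if i ∈ T.cols then -i else i
  | .south => i

theorem isRowLabel_label (T : PermTableauB n) {i : ℤ} (hi : i ∈ Finset.Icc 1 (n : ℤ)) :
    IsRowLabel n T.cols (T.label .east i) := by
  rw [Finset.mem_Icc] at hi
  simp only [label, IsRowLabel]
  split_ifs with hc <;> simp [hc, hi]

theorem label_injOn (T : PermTableauB n) (d : Dir) :
    Set.InjOn (T.label d) (Finset.Icc 1 (n : ℤ)) := by
  intro i hi j hj h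
  rw [Finset.mem_coe, Finset.mem_Icc] at hi hj
  cases d <;> simp only [label] at h
  · split_ifs at h <;> omega
  · exact h

theorem exists_label_eq (T : PermTableauB n) {d : Dir} {j : ℤ} (h : T.IsLabel d j) :
    ∃ i ∈ Finset.Icc 1 (n : ℤ), T.label d i = j := by
  cases d
  · rcases h with hj | hj
    · exact ⟨j, Finset.mem_Icc.2 ⟨hj.1, hj.2.1⟩, if_neg hj.2.2⟩
    · exact ⟨-j, T.cols_subset hj, by simp [label, hj]⟩
  · exact ⟨j, T.cols_subset h, rfl⟩

theorem ncard_eq_sum (T : PermTableauB n) (d d' : Dir) {A : Set (ℤ × ℤ)}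
    (hA : ∀ p ∈ A, T.IsLabel d p.1 ∧ T.IsLabel d' p.2) (Q : ℤ → ℤ → Prop)
    [∀ i j, Decidable (Q i j)] (hQ : ∀ i ∈ Finset.Icc 1 (n : ℤ), ∀ j ∈ Finset.Icc 1 (n : ℤ),
      (T.label d i, T.label d' j) ∈ A ↔ Q i j) :
    (A.ncard : ℤ) = ∑ i ∈ Finset.Icc 1 (n : ℤ), ∑ j ∈ Finset.Icc 1 (n : ℤ),
      if Q i j then 1 else 0 := by
  rw [← Finset.sum_product', Finset.sum_boole, Nat.cast_inj, ← Set.ncard_coe_finset]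
  symm
  refine Set.ncard_congr (fun p _ => (T.label d p.1, T.label d' p.2)) ?_ ?_ ?_
  · rintro ⟨i, j⟩ hp
    obtain ⟨hp, hij⟩ := Finset.mem_filter.1 hp
    obtain ⟨hi, hj⟩ := Finset.mem_product.1 hp
    exact (hQ i hi j hj).2 hij
  · intro p q hp hq heq
    obtain ⟨hp₁, hp₂⟩ := Finset.mem_product.1 (Finset.mem_filter.1 hp).1
    obtain ⟨hq₁, hq₂⟩ := Finset.mem_product.1 (Finset.mem_filter.1 hq).1
    rw [Prod.mk.injEq] at heq
    exact Prod.ext (T.label_injOn d hp₁ hq₁ heq.1) (T.label_injOn d' hp₂ hq₂ heq.2)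
  · rintro ⟨a, b⟩ hab
    obtain ⟨i, hi, rfl⟩ := T.exists_label_eq (hA _ hab).1
    obtain ⟨j, hj, rfl⟩ := T.exists_label_eq (hA _ hab).2
    exact ⟨(i, j), Finset.mem_filter.2 ⟨Finset.mem_product.2 ⟨hi, hj⟩, (hQ i hi j hj).1 hab⟩, rfl⟩

/-- The end of the path from the row that belongs to `i ∈ [n]`. -/
def rowEnd (T : PermTableauB n) (i : ℤ) : ℤ := T.endLabel (start n .east (T.label .east i))

/-- The end of the path from column `i`. -/
def colEnd (T : PermTableauB n) (i : ℤ) : ℤ := T.endLabel (start n .south i)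

theorem endLabel_rowStart_of_diag_notMem (T : PermTableauB n) {i : ℤ} (hi : i ∈ T.cols)
    (hdiag : (-i, i) ∉ T.ones) : T.endLabel (rowStart n (-i)) = -i := by
  unfold endLabel rowStart
  rw [T.iterate_east fun _ _ => T.diag i hi hdiag _]

theorem endLabel_colStart_of_diag_mem (T : PermTableauB n) {i : ℤ} (hdiag : (-i, i) ∈ T.ones) :
    T.endLabel (colStart n i) = -i := by
  have hi := T.mem_cols_bounds (T.ones_spec hdiag).2.1
  have hdown : T.step^[(n - i).toNat] (colStart n i) = ⟨.south, -i, i⟩ := by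
    rw [colStart, T.iterate_south]
    · congr 1
      omega
    · intro m hm hone
      have := (T.ones_spec hone).2.2.1
      omega
  rw [← T.endLabel_of_iterate_eq hdown (by omega), ← T.endLabel_step (by simp only; omega),
    (T.step_of_mem hdiag).2, T.endLabel_east_of_lt_neg (by omega)]

theorem zetaPos_cases (T : PermTableauB n) {i : ℤ} (hi : 1 ≤ i) (hi' : i ≤ n) :
    (i ∉ T.cols ∧ T.zetaPos i = T.rowEnd i ∧ i ≤ T.rowEnd i) ∨
    (i ∈ T.cols ∧ T.zetaPos i = T.colEnd i ∧ 1 ≤ T.colEnd i ∧ T.colEnd i ≤ i ∧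
      T.rowEnd i = -i) ∨
    (i ∈ T.cols ∧ T.zetaPos i = -T.rowEnd i ∧ 1 ≤ T.rowEnd i ∧ T.colEnd i = -i) := by
  obtain ⟨p, hp, hpos, -, -⟩ := T.end_spec i hi hi'
  simp only [rowEnd, colEnd, label, zetaPos, zetaStart] at hp ⊢
  rw [T.endLabel_start_south (by omega) hi']
  by_cases hc : i ∈ T.cols
  · simp only [hc, not_true_eq_false, if_true, if_false] at hp ⊢
    rw [T.endLabel_start_east (by omega) (by omega)]
    by_cases hdiag : (-i, i) ∈ T.ones
    · simp only [hdiag, not_true_eq_false, if_false] at hp ⊢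
      exact Or.inr (Or.inr ⟨trivial, trivial, by omega, T.endLabel_colStart_of_diag_mem hdiag⟩)
    · simp only [hdiag, not_false_eq_true, if_true] at hp ⊢
      refine Or.inr (Or.inl
        ⟨trivial, trivial, by omega, ?_, T.endLabel_rowStart_of_diag_notMem hc hdiag⟩)
      exact T.endLabel_le_col (s := colStart n i) (by simp only [colStart]; omega)
  · simp only [hc, not_false_eq_true, if_true, if_false] at hp ⊢
    rw [T.endLabel_start_east (by omega) (by omega)]
    exact Or.inl ⟨trivial, rfl, T.row_le_endLabel (rowStart n i)⟩

theorem mem_crossings_east_east (T : PermTableauB n) {i j : ℤ} (hi : i ∈ Finset.Icc 1 (n : ℤ))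
    (hj : j ∈ Finset.Icc 1 (n : ℤ)) :
    (T.label .east i, T.label .east j) ∈ T.crossings .east .east ↔
      T.label .east i < T.label .east j ∧ T.rowEnd j < T.rowEnd i := by
  simp only [crossings, Set.mem_ofPred_eq, IsLabel, T.isRowLabel_label hi, T.isRowLabel_label hj,
    true_and, reduceCtorEq, false_imp_iff, and_true, rowEnd]
  refine and_congr_left fun _ => ?_
  simp only [start, ZState.rank]
  omega

theorem mem_crossings_south_south (T : PermTableauB n) {i j : ℤ} :
    (T.label .south i, T.label .south j) ∈ T.crossings .south .south ↔
      i ∈ T.cols ∧ j ∈ T.cols ∧ i < j ∧ T.colEnd j < T.colEnd i ∧ -i ≤ T.colEnd j := by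
  simp only [crossings, Set.mem_ofPred_eq, IsLabel, label, colEnd, forall_const, start, ZState.rank,
    mul_lt_mul_iff_right₀ (two_pos : (0 : ℤ) < 2)]

theorem mem_crossings_south_east (T : PermTableauB n) {i j : ℤ}
    (hj : j ∈ Finset.Icc 1 (n : ℤ)) :
    (T.label .south i, T.label .east j) ∈ T.crossings .south .east ↔
      i ∈ T.cols ∧ T.rowEnd j < T.colEnd i ∧ -i ≤ T.rowEnd j := by
  have hlabel := T.isRowLabel_label hj
  simp only [crossings, Set.mem_ofPred_eq, IsLabel, hlabel, true_and, rowEnd, colEnd, forall_const]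
  refine and_congr_right fun hi => ?_
  have := T.mem_cols_bounds hi
  have := T.isRowLabel_bounds hlabel
  simp only [label] at *
  simp only [start, ZState.rank, and_iff_right_iff_imp]
  omega

theorem mem_boxes_label (T : PermTableauB n) {i j : ℤ} (hi : i ∈ Finset.Icc 1 (n : ℤ)) :
    (T.label .east i, T.label .south j) ∈ T.boxes ↔ j ∈ T.cols ∧ i ≤ j := by
  have habs : |T.label .east i| = i := by
    rw [Finset.mem_Icc] at hi
    simp only [label]
    split_ifs
    · rw [abs_neg, abs_of_pos (by omega)]
    · rw [abs_of_pos (by omega)]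
  simp only [boxes, Set.mem_ofPred_eq, IsBox, T.isRowLabel_label hi, habs, true_and]
  rfl

/-- The contribution of the labels `i, j ∈ [n]` to the number of inversions of `ζ(T)`. -/
def invWeight (T : PermTableauB n) (i j : ℤ) : ℤ :=
  (if i < j ∧ T.zetaPos j < T.zetaPos i then 1 else 0) +
    if i ≤ j ∧ T.zetaPos j < -T.zetaPos i then 1 else 0

/-- The contribution of the labels `i, j ∈ [n]` to the number of boxes plus the numbers of crossings
of two row paths or two column paths, minus the number of crossings of a column path with a row
path. -/
def tableauWeight (T : PermTableauB n) (i j : ℤ) : ℤ :=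
  (if j ∈ T.cols ∧ i ≤ j then 1 else 0) +
    (if T.label .east i < T.label .east j ∧ T.rowEnd j < T.rowEnd i then 1 else 0) +
    (if i ∈ T.cols ∧ j ∈ T.cols ∧ i < j ∧ T.colEnd j < T.colEnd i ∧ -i ≤ T.colEnd j then 1 else 0) -
    if i ∈ T.cols ∧ T.rowEnd j < T.colEnd i ∧ -i ≤ T.rowEnd j then 1 else 0

theorem sum_invWeight (T : PermTableauB n) :
    ∑ i ∈ Finset.Icc 1 (n : ℤ), ∑ j ∈ Finset.Icc 1 (n : ℤ), T.invWeight i j =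
      SignedPerm.inv T.zeta := by
  rw [SignedPerm.inv_eq_sum]
  refine Finset.sum_congr rfl fun i hi => Finset.sum_congr rfl fun j hj => ?_
  rw [Finset.mem_Icc] at hi hj
  rw [T.toPerm_zeta hi.1 hi.2, T.toPerm_zeta hj.1 hj.2, invWeight]

theorem sum_tableauWeight (T : PermTableauB n) :
    ∑ i ∈ Finset.Icc 1 (n : ℤ), ∑ j ∈ Finset.Icc 1 (n : ℤ), T.tableauWeight i j =
      T.boxes.ncard + T.zeroEE + T.zeroNN - (T.crossings .south .east).ncard := by
  have hlabel (d d' : Dir) : ∀ p ∈ T.crossings d d', T.IsLabel d p.1 ∧ T.IsLabel d' p.2 :=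
    fun p hp => ⟨hp.1, hp.2.1⟩
  rw [zeroEE_eq, zeroNN_eq,
    T.ncard_eq_sum .east .south (fun p hp => ⟨hp.1, hp.2.1⟩) _ fun i hi j _ => T.mem_boxes_label hi,
    T.ncard_eq_sum _ _ (hlabel _ _) _ fun i hi j hj => T.mem_crossings_east_east hi hj,
    T.ncard_eq_sum _ _ (hlabel _ _) _ fun i _ j _ => T.mem_crossings_south_south,
    T.ncard_eq_sum _ _ (hlabel _ _) _ fun i _ j hj => T.mem_crossings_south_east hj]
  simp only [← Finset.sum_add_distrib, ← Finset.sum_sub_distrib, tableauWeight]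

theorem invWeight_self (T : PermTableauB n) {i : ℤ} (hi : 1 ≤ i) (hi' : i ≤ n) :
    T.invWeight i i = T.tableauWeight i i := by
  simp only [invWeight, tableauWeight, lt_irrefl, le_refl, true_and, false_and, and_false, if_false]
  rcases T.zetaPos_cases hi hi' with ⟨hc, h⟩ | ⟨hc, h⟩ | ⟨hc, h⟩ <;>
    simp only [hc, true_and, false_and, if_true, if_false] <;> split_ifs <;> omega

theorem invWeight_add_swap_of_lt (T : PermTableauB n) {i j : ℤ} (hi : 1 ≤ i) (hij : i < j)
    (hj : j ≤ n) :
    T.invWeight i j + T.invWeight j i = T.tableauWeight i j + T.tableauWeight j i := by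
  have hne : |T.zetaPos i| ≠ |T.zetaPos j| := fun h =>
    hij.ne (T.abs_zetaPos_inj i j hi (by omega) (by omega) hj h)
  rw [Ne, abs_eq_abs, not_or] at hne
  obtain ⟨hne, hne'⟩ := hne
  simp only [invWeight, tableauWeight, label, hij, hij.le, hij.not_gt, hij.not_ge, true_and,
    and_true, false_and, and_false, if_false]
  rcases T.zetaPos_cases hi (by omega) with ⟨hc, h⟩ | ⟨hc, h⟩ | ⟨hc, h⟩ <;>
    rcases T.zetaPos_cases (by omega) hj with ⟨hc', h'⟩ | ⟨hc', h'⟩ | ⟨hc', h'⟩ <;>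
    simp only [hc, hc', if_true, if_false, true_and, false_and] <;> split_ifs <;> omega

theorem invWeight_add_swap (T : PermTableauB n) {i j : ℤ} (hi : i ∈ Finset.Icc 1 (n : ℤ))
    (hj : j ∈ Finset.Icc 1 (n : ℤ)) :
    T.invWeight i j + T.invWeight j i = T.tableauWeight i j + T.tableauWeight j i := by
  rw [Finset.mem_Icc] at hi hj
  rcases lt_trichotomy i j with hij | rfl | hij
  · exact T.invWeight_add_swap_of_lt hi.1 hij hj.2
  · rw [T.invWeight_self hi.1 hi.2]
  · rw [add_comm, T.invWeight_add_swap_of_lt hj.1 hij hi.2, add_comm]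

theorem inv_zeta (T : PermTableauB n) :
    SignedPerm.inv T.zeta = 2 * (T.zeroEE + T.zeroNN) + T.one := by
  have hinv := sum_sum_eq_of_add_swap_eq _ _ _ fun i hi j hj => T.invWeight_add_swap hi hj
  rw [sum_invWeight, sum_tableauWeight, ncard_boxes] at hinv
  push_cast at hinv
  omega

end PermTableauB

/-! ### Injectivity of the zigzag map -/

namespace PermTableauB

variable {n : ℕ}

theorem endLabel_south_lt_of_mem_ones (T : PermTableauB n) {r c : ℤ} (h : (r, c) ∈ T.ones)
    (k : ℕ) : T.endLabel ⟨.south, r - k, c⟩ < c := by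
  have hrc := (T.ones_spec h).2.2.2
  induction k with
  | zero =>
    have hend := T.endLabel_le_col (s := ⟨.east, r, c - 1⟩) (by simp only; omega)
    rw [← (T.step_of_mem h).2, T.endLabel_step hrc, (T.step_of_mem h).2] at hend
    rw [Nat.cast_zero, sub_zero]
    exact Int.lt_of_le_sub_one hend
  | succ k ih =>
    rw [← T.endLabel_step (by simp only; omega)]
    by_cases hone : (r - (k + 1 : ℕ), c) ∈ T.ones
    · rw [(T.step_of_mem hone).2]
      exact Int.lt_of_le_sub_one (T.endLabel_le_col (s := ⟨.east, _, c - 1⟩) (by simp only; omega))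
    · rwa [(T.step_of_notMem hone).2, show r - ((k + 1 : ℕ) : ℤ) + 1 = r - k by push_cast; ring]

theorem colEnd_lt (T : PermTableauB n) {i : ℤ} (hi : i ∈ T.cols) : T.colEnd i < i := by
  obtain ⟨r, hr⟩ := T.exists_one i hi
  have hbox := T.ones_spec hr
  have hin := (T.mem_cols_bounds hi).2
  have hlt := T.endLabel_south_lt_of_mem_ones hr (r - (i - 2 * n)).toNat
  rwa [show r - ((r - (i - 2 * n)).toNat : ℤ) = i - 2 * n by omega] at hlt

theorem mem_cols_iff (T : PermTableauB n) {i : ℤ} (hi : 1 ≤ i) (hi' : i ≤ n) :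
    i ∈ T.cols ↔ T.zetaPos i < i := by
  rcases T.zetaPos_cases hi hi' with ⟨hrow, hends⟩ | ⟨hcol, hends⟩ | ⟨hcol, hends⟩
  · simp only [hrow, false_iff, not_lt]
    omega
  · have := T.colEnd_lt hcol
    simp only [hcol, true_iff]
    omega
  · simp only [hcol, true_iff]
    omega

section

variable {T T' : PermTableauB n}

theorem cols_eq_of_zetaPos_eq
    (h : ∀ i : ℤ, 1 ≤ i → i ≤ n → T.zetaPos i = T'.zetaPos i) : T.cols = T'.cols := by
  ext i
  by_cases hi : 1 ≤ i ∧ i ≤ n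
  · rw [T.mem_cols_iff hi.1 hi.2, T'.mem_cols_iff hi.1 hi.2, h i hi.1 hi.2]
  · exact iff_of_false (mt T.mem_cols_bounds hi) (mt T'.mem_cols_bounds hi)

theorem rowEnd_colEnd_eq_of_zetaPos_eq {i : ℤ} (hi : 1 ≤ i) (hi' : i ≤ n)
    (hC : T.cols = T'.cols) (h : T.zetaPos i = T'.zetaPos i) :
    T.rowEnd i = T'.rowEnd i ∧ (i ∈ T.cols → T.colEnd i = T'.colEnd i) := by
  have hT := T.zetaPos_cases hi hi'
  have hT' := T'.zetaPos_cases hi hi'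
  rw [← hC, ← h] at hT'
  by_cases hcol : i ∈ T.cols
  · simp only [hcol, not_true_eq_false, false_and, true_and, false_or, forall_const] at hT hT' ⊢
    omega
  · simp only [hcol, not_false_eq_true, true_and, false_and, or_false, false_imp_iff,
      and_true] at hT hT' ⊢
    omega

theorem endLabel_start_eq_of_zetaPos_eq
    (h : ∀ i : ℤ, 1 ≤ i → i ≤ n → T.zetaPos i = T'.zetaPos i) {d : Dir} {j : ℤ}
    (hj : T.IsLabel d j) : T.endLabel (start n d j) = T'.endLabel (start n d j) := by
  have hC := cols_eq_of_zetaPos_eq h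
  obtain ⟨i, hi, -, rfl⟩ := T.exists_label_eq hj
  obtain ⟨hi, hi'⟩ := Finset.mem_Icc.1 hi
  have hends := rowEnd_colEnd_eq_of_zetaPos_eq hi hi' hC (h i hi hi')
  cases d with
  | east => simpa only [rowEnd, label, ← hC] using hends.1
  | south => exact hends.2 hj

theorem mem_ones_congr {r c : ℤ} (hC : T.cols = T'.cols) (hrc : r < c)
    (h : ∀ d, T.Valid ⟨d, r, c⟩ → T.endLabel ⟨d, r, c⟩ = T'.endLabel ⟨d, r, c⟩) :
    (r, c) ∈ T.ones ↔ (r, c) ∈ T'.ones := by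
  by_cases hvalid : IsRowLabel n T.cols r ∧ c ∈ T.cols
  · obtain ⟨hr, hc⟩ := hvalid
    rw [T.mem_ones_iff hr hc hrc, T'.mem_ones_iff (hC ▸ hr) (hC ▸ hc) hrc, h .south hc, h .east hr]
  · refine iff_of_false (fun hone => hvalid ?_) (fun hone => hvalid ?_)
    · exact ⟨(T.ones_spec hone).1, (T.ones_spec hone).2.1⟩
    · exact hC ▸ ⟨(T'.ones_spec hone).1, (T'.ones_spec hone).2.1⟩

theorem step_congr {s : ZState} (h : (s.row, s.col) ∈ T.ones ↔ (s.row, s.col) ∈ T'.ones) :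
    T.step s = T'.step s := by
  obtain ⟨d, r, c⟩ := s
  cases d <;> simp only [step, h]

theorem endLabel_congr (hC : T.cols = T'.cols)
    (h : ∀ d j, T.IsLabel d j → T.endLabel (start n d j) = T'.endLabel (start n d j))
    {s : ZState} (hs : T.Valid s) (hrc : s.row ≤ s.col) (hdiff : s.col - s.row ≤ 2 * n) :
    T.endLabel s = T'.endLabel s := by
  obtain ⟨m, hm⟩ : ∃ m : ℕ, s.col - s.row = 2 * n - m :=
    ⟨(2 * n - (s.col - s.row)).toNat, by omega⟩
  induction m generalizing s with
  | zero =>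
    obtain ⟨d, r, c⟩ := s
    simp only [Nat.cast_zero, sub_zero] at hm
    cases d with
    | east =>
      obtain rfl : c = r + 2 * n := by omega
      exact h .east r hs
    | south =>
      obtain rfl : r = c - 2 * n := by omega
      exact h .south c hs
  | succ m ih =>
    push_cast at hm
    obtain ⟨s', hs', rfl⟩ := T.exists_step_eq hs
    have hdiff' := T.step_diff s'
    have hone : (s'.row, s'.col) ∈ T.ones ↔ (s'.row, s'.col) ∈ T'.ones :=
      mem_ones_congr hC (by omega) fun d hd =>
        ih hd (by simp only; omega) (by simp only; omega) (by simp only; omega)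
    rw [T.endLabel_step (by omega), step_congr hone, T'.endLabel_step (by omega)]
    exact ih hs' (by omega) (by omega) (by omega)

end

theorem zeta_injective : Function.Injective (zeta (n := n)) := by
  intro T T' h
  have hpos (i : ℤ) (hi : 1 ≤ i) (hi' : i ≤ n) : T.zetaPos i = T'.zetaPos i := by
    rw [← T.toPerm_zeta hi hi', ← T'.toPerm_zeta hi hi', h]
  have hC := cols_eq_of_zetaPos_eq hpos
  refine PermTableauB.ext hC (Finset.ext fun ⟨r, c⟩ => ?_)
  by_cases hrc : -c ≤ r ∧ r < c ∧ c ≤ n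
  · refine mem_ones_congr hC hrc.2.1 fun d hd => ?_
    exact endLabel_congr hC (fun d j => endLabel_start_eq_of_zetaPos_eq hpos) hd
      (by simp only; omega) (by simp only; omega)
  · have hout (S : PermTableauB n) : (r, c) ∉ S.ones := fun hone =>
      hrc ⟨(S.ones_spec hone).2.2.1, (S.ones_spec hone).2.2.2,
        (S.mem_cols_bounds (S.ones_spec hone).2.1).2⟩
    exact iff_of_false (hout T) (hout T')

end PermTableauB

/-! ### Surjectivity of the zigzag map -/

/-- The finite set of the row labels of the shifted diagram with column labels `C`. -/
noncomputable def rowLabels (n : ℕ) (C : Finset ℤ) : Finset ℤ :=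
  (Finset.Icc 1 (n : ℤ) \ C) ∪ C.image Neg.neg

theorem mem_rowLabels {n : ℕ} {C : Finset ℤ} {r : ℤ} : r ∈ rowLabels n C ↔ IsRowLabel n C r := by
  simp only [rowLabels, IsRowLabel, Finset.mem_union, Finset.mem_sdiff, Finset.mem_Icc,
    Finset.mem_image, neg_eq_iff_eq_neg, exists_eq_right, and_assoc]

/-- A prescription of the ends of all paths in a tableau with column labels `cols`: the path from
row `r` is to end at `rowEnd r`, and the path from column `c` at `colEnd c`. -/
structure PathEnds (n : ℕ) where
  cols : Finset ℤ
  cols_subset : cols ⊆ Finset.Icc 1 (n : ℤ)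
  rowEnd : ℤ → ℤ
  colEnd : ℤ → ℤ
  rowEnd_mem : ∀ r ∈ rowLabels n cols, rowEnd r ∈ rowLabels n cols ∪ cols
  colEnd_mem : ∀ c ∈ cols, colEnd c ∈ rowLabels n cols ∪ cols
  le_rowEnd : ∀ r ∈ rowLabels n cols, r ≤ rowEnd r
  colEnd_lt : ∀ c ∈ cols, colEnd c < c
  neg_le_colEnd : ∀ c ∈ cols, -c ≤ colEnd c
  rowEnd_injOn : Set.InjOn rowEnd (rowLabels n cols)
  colEnd_injOn : Set.InjOn colEnd cols
  rowEnd_ne_colEnd : ∀ r ∈ rowLabels n cols, ∀ c ∈ cols, rowEnd r ≠ colEnd c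
  diag : ∀ c ∈ cols, colEnd c = -c ∨ rowEnd (-c) = -c

namespace PathEnds

variable {n : ℕ}

/-- The row labels of the tableau with the prescribed ends. -/
noncomputable def rows (D : PathEnds n) : Finset ℤ := rowLabels n D.cols

theorem mem_cols_bounds (D : PathEnds n) {c : ℤ} (hc : c ∈ D.cols) : 1 ≤ c ∧ c ≤ n :=
  Finset.mem_Icc.1 (D.cols_subset hc)

theorem mem_rows_bounds (D : PathEnds n) {r : ℤ} (hr : r ∈ D.rows) : -(n : ℤ) ≤ r ∧ r ≤ n := by
  rcases mem_rowLabels.1 hr with hr | hr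
  · omega
  · have := D.mem_cols_bounds hr
    omega

theorem notMem_cols_of_mem_rows (D : PathEnds n) {r : ℤ} (hr : r ∈ D.rows) : r ∉ D.cols := by
  rcases mem_rowLabels.1 hr with hr | hr
  · exact hr.2.2
  · intro hr'
    have := D.mem_cols_bounds hr
    have := D.mem_cols_bounds hr'
    omega

theorem neg_mem_rows (D : PathEnds n) {c : ℤ} (hc : c ∈ D.cols) : -c ∈ D.rows :=
  mem_rowLabels.2 (Or.inr (by rwa [neg_neg]))

theorem neg_mem_cols (D : PathEnds n) {r : ℤ} (hr : r ∈ D.rows) (hneg : r < 0) : -r ∈ D.cols :=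
  (mem_rowLabels.1 hr).resolve_left (by omega)

/-- The prescribed end of the path that enters column `c` from the north above row `r`, where `v`
gives the ends of the paths that enter this column from the west. At each row the path that ends
first leaves column `c`, so the one that goes on south has the greatest end met so far. -/
noncomputable def southEndAux (D : PathEnds n) (v : ℤ → ℤ) (c r : ℤ) : ℤ :=
  (D.rows.filter (· < r)).fold max (D.colEnd c) v

/-- The prescribed ends of the paths that enter column `n - m` from the west. -/
noncomputable def eastEndAux (D : PathEnds n) : ℕ → ℤ → ℤ
  | 0, r => D.rowEnd r
  | m + 1, r =>
    if (n - m : ℤ) ∈ D.cols ∧ r < n - m then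
      min (D.southEndAux (D.eastEndAux m) (n - m) r) (D.eastEndAux m r)
    else D.eastEndAux m r

/-- The prescribed end of the path that enters the place `(r, c)` moving east. For `c > n` this is a
junk value. -/
noncomputable def eastEnd (D : PathEnds n) (c r : ℤ) : ℤ := D.eastEndAux (n - c).toNat r

/-- The prescribed end of the path that enters the place `(r, c)` moving south. -/
noncomputable def southEnd (D : PathEnds n) (c r : ℤ) : ℤ := D.southEndAux (D.eastEnd c) c r

theorem eastEnd_top (D : PathEnds n) (r : ℤ) : D.eastEnd n r = D.rowEnd r := by
  simp [eastEnd, eastEndAux]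

theorem eastEnd_pred (D : PathEnds n) {c : ℤ} (hc : c ≤ n) (r : ℤ) :
    D.eastEnd (c - 1) r =
      if c ∈ D.cols ∧ r < c then min (D.southEnd c r) (D.eastEnd c r) else D.eastEnd c r := by
  obtain ⟨m, rfl⟩ : ∃ m : ℕ, c = n - m := ⟨(n - c).toNat, by omega⟩
  have hm : (n - (n - m) : ℤ).toNat = m := by omega
  have hm' : (n - (n - m - 1) : ℤ).toNat = m + 1 := by omega
  have heast : D.eastEnd (n - m) = D.eastEndAux m := funext fun r => by rw [eastEnd, hm]
  rw [southEnd, heast, eastEnd, hm', eastEndAux]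

theorem eastEnd_pred_of_lt (D : PathEnds n) {c r : ℤ} (hc : c ∈ D.cols) (hrc : r < c) :
    D.eastEnd (c - 1) r = min (D.southEnd c r) (D.eastEnd c r) := by
  rw [D.eastEnd_pred (D.mem_cols_bounds hc).2, if_pos ⟨hc, hrc⟩]

theorem eastEnd_pred_of_le (D : PathEnds n) {c r : ℤ} (hc : c ≤ n) (hcr : c ≤ r) :
    D.eastEnd (c - 1) r = D.eastEnd c r := by
  rw [D.eastEnd_pred hc, if_neg fun h => hcr.not_gt h.2]

theorem eastEnd_pred_of_notMem (D : PathEnds n) {c : ℤ} (hn : c ≤ n) (hc : c ∉ D.cols) (r : ℤ) :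
    D.eastEnd (c - 1) r = D.eastEnd c r := by
  rw [D.eastEnd_pred hn, if_neg fun h => hc h.1]

theorem eastEnd_pred_le (D : PathEnds n) {c : ℤ} (hc : c ≤ n) (r : ℤ) :
    D.eastEnd (c - 1) r ≤ D.eastEnd c r := by
  rw [D.eastEnd_pred hc]
  split_ifs
  · exact min_le_right _ _
  · rfl

theorem colEnd_le_southEnd (D : PathEnds n) (c r : ℤ) : D.colEnd c ≤ D.southEnd c r :=
  (Finset.le_fold_max _).2 (Or.inl le_rfl)

theorem eastEnd_le_southEnd (D : PathEnds n) (c : ℤ) {r r' : ℤ} (hr : r ∈ D.rows) (hlt : r < r') :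
    D.eastEnd c r ≤ D.southEnd c r' :=
  (Finset.le_fold_max _).2 (Or.inr ⟨r, Finset.mem_filter.2 ⟨hr, hlt⟩, le_rfl⟩)

theorem southEnd_le_iff (D : PathEnds n) (c r x : ℤ) :
    D.southEnd c r ≤ x ↔ D.colEnd c ≤ x ∧ ∀ r' ∈ D.rows, r' < r → D.eastEnd c r' ≤ x := by
  simp only [southEnd, southEndAux, Finset.fold_max_le, Finset.mem_filter, and_imp]

theorem southEnd_lt_iff (D : PathEnds n) (c r x : ℤ) :
    D.southEnd c r < x ↔ D.colEnd c < x ∧ ∀ r' ∈ D.rows, r' < r → D.eastEnd c r' < x := by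
  simp only [southEnd, southEndAux, Finset.fold_max_lt, Finset.mem_filter, and_imp]

theorem southEnd_mono (D : PathEnds n) (c : ℤ) {r r' : ℤ} (h : r ≤ r') :
    D.southEnd c r ≤ D.southEnd c r' :=
  (D.southEnd_le_iff _ _ _).2 ⟨D.colEnd_le_southEnd _ _,
    fun _ hx hlt => D.eastEnd_le_southEnd c hx (hlt.trans_le h)⟩

theorem southEnd_eq (D : PathEnds n) (c r : ℤ) :
    D.southEnd c r = D.colEnd c ∨ ∃ r' ∈ D.rows, r' < r ∧ D.southEnd c r = D.eastEnd c r' := by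
  by_contra! h
  exact lt_irrefl _ <| (D.southEnd_lt_iff c r _).2 ⟨(D.colEnd_le_southEnd c r).lt_of_ne h.1.symm,
    fun r' hr' hlt => (D.eastEnd_le_southEnd c hr' hlt).lt_of_ne (h.2 r' hr' hlt).symm⟩

theorem eastEnd_pred_eq (D : PathEnds n) {c r : ℤ} (hc : c ∈ D.cols)
    (hr : r ∈ D.rows) : D.eastEnd (c - 1) r = D.colEnd c ∨
      ∃ r' ∈ D.rows, r' ≤ r ∧ D.eastEnd (c - 1) r = D.eastEnd c r' := by
  rcases lt_or_ge r c with hrc | hcr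
  · rw [D.eastEnd_pred_of_lt hc hrc]
    rcases min_choice (D.southEnd c r) (D.eastEnd c r) with heq | heq <;> rw [heq]
    · exact (D.southEnd_eq c r).imp_right fun ⟨r', hr', hlt, heq'⟩ => ⟨r', hr', hlt.le, heq'⟩
    · exact Or.inr ⟨r, hr, le_rfl, rfl⟩
  · exact Or.inr ⟨r, hr, le_rfl, D.eastEnd_pred_of_le (D.mem_cols_bounds hc).2 hcr⟩

theorem southEnd_succ_of_mem (D : PathEnds n) (c : ℤ) {r : ℤ} (hr : r ∈ D.rows) :
    D.southEnd c (r + 1) = max (D.southEnd c r) (D.eastEnd c r) := by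
  refine le_antisymm ((D.southEnd_le_iff _ _ _).2
    ⟨le_max_of_le_left (D.colEnd_le_southEnd _ _), fun r' hr' hlt => ?_⟩)
    (max_le (D.southEnd_mono c (by omega)) (D.eastEnd_le_southEnd c hr (by omega)))
  rcases (Int.lt_add_one_iff.1 hlt).eq_or_lt with rfl | hlt
  · exact le_max_right _ _
  · exact le_max_of_le_left (D.eastEnd_le_southEnd c hr' hlt)

theorem southEnd_succ_of_notMem (D : PathEnds n) (c : ℤ) {r : ℤ} (hr : r ∉ D.rows) :
    D.southEnd c (r + 1) = D.southEnd c r := by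
  refine le_antisymm ((D.southEnd_le_iff _ _ _).2 ⟨D.colEnd_le_southEnd _ _, fun r' hr' hlt => ?_⟩)
    (D.southEnd_mono c (by omega))
  exact D.eastEnd_le_southEnd c hr' ((Int.lt_add_one_iff.1 hlt).lt_of_ne fun h => hr (h ▸ hr'))

/-- The ends prescribed for the paths that enter column `c` from the west, and for the columns up to
`c`, are distinct labels that the remaining part of the diagram allows the paths to reach. -/
structure Consistent (D : PathEnds n) (c : ℤ) : Prop where
  le_eastEnd : ∀ r ∈ D.rows, r ≤ D.eastEnd c r
  eastEnd_le_rowEnd : ∀ r ∈ D.rows, D.eastEnd c r ≤ D.rowEnd r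
  eastEnd_mem : ∀ r ∈ D.rows, D.eastEnd c r ∈ D.rows ∪ D.cols
  eastEnd_injOn : Set.InjOn (D.eastEnd c) D.rows
  eastEnd_ne_colEnd : ∀ r ∈ D.rows, ∀ c' ∈ D.cols, c' ≤ c → D.eastEnd c r ≠ D.colEnd c'
  eastEnd_le : ∀ r ∈ D.rows, r ≤ c → D.eastEnd c r ≤ c
  eastEnd_neg : ∀ i ∈ D.cols, c < i → D.eastEnd c (-i) = -i

namespace Consistent

variable {D : PathEnds n} {c : ℤ}

theorem eastEnd_of_lt_neg (h : D.Consistent c) {r : ℤ} (hr : r ∈ D.rows) (hneg : r < 0)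
    (hrc : r < -c) : D.eastEnd c r = r := by
  simpa only [neg_neg] using h.eastEnd_neg (-r) (D.neg_mem_cols hr hneg) (by omega)

-- The paths that start on the labels below `r` and the one from column `c` have distinct ends, so
-- they cannot all end below `r`.
theorem le_southEnd (h : D.Consistent c) (hc : c ∈ D.cols) {r : ℤ} (hr : r ≤ c) :
    r ≤ D.southEnd c r := by
  by_contra! hlt
  obtain ⟨hcol, hrow⟩ := (D.southEnd_lt_iff c r r).1 hlt
  let below (s : Finset ℤ) := s.filter (· < r)
  have hdisj : Disjoint (below D.rows) (below D.cols) :=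
    Finset.disjoint_filter_filter (Finset.disjoint_left.2 fun _ => D.notMem_cols_of_mem_rows)
  have hcB : c ∉ below D.cols := fun hmem => hr.not_gt (Finset.mem_filter.1 hmem).2
  have hcols : ∀ x ∈ insert c (below D.cols), x ∈ D.cols ∧ x ≤ c ∧ D.colEnd x < r := by
    intro x hx
    rcases Finset.mem_insert.1 hx with rfl | hx
    · exact ⟨hc, le_rfl, hcol⟩
    · obtain ⟨hx, hxr⟩ := Finset.mem_filter.1 hx
      exact ⟨hx, by omega, (D.colEnd_lt x hx).trans hxr⟩
  have hends : (below D.rows).image (D.eastEnd c) ∪ (insert c (below D.cols)).image D.colEnd ⊆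
      below D.rows ∪ below D.cols := by
    rw [← Finset.filter_union]
    refine Finset.union_subset (Finset.image_subset_iff.2 fun x hx => ?_)
      (Finset.image_subset_iff.2 fun x hx => ?_)
    · obtain ⟨hx, hxr⟩ := Finset.mem_filter.1 hx
      exact Finset.mem_filter.2 ⟨h.eastEnd_mem x hx, hrow x hx hxr⟩
    · obtain ⟨hx, -, hxr⟩ := hcols x hx
      exact Finset.mem_filter.2 ⟨D.colEnd_mem x hx, hxr⟩
  have hcard := Finset.card_le_card hends
  rw [Finset.card_union_of_disjoint hdisj, Finset.card_union_of_disjoint,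
    Finset.card_image_of_injOn, Finset.card_image_of_injOn,
    Finset.card_insert_of_notMem hcB] at hcard
  · omega
  · exact D.colEnd_injOn.mono fun x hx => (hcols x hx).1
  · exact h.eastEnd_injOn.mono (Finset.filter_subset _ _)
  · simp only [Finset.disjoint_left, Finset.mem_image, not_exists, not_and]
    rintro _ ⟨x, hx, rfl⟩ y hy hxy
    obtain ⟨hy, hyc, -⟩ := hcols y hy
    exact h.eastEnd_ne_colEnd x (Finset.mem_filter.1 hx).1 y hy hyc hxy.symm

theorem southEnd_ne_eastEnd (h : D.Consistent c) (hc : c ∈ D.cols) {r : ℤ} (hr : r ∈ D.rows) :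
    D.southEnd c r ≠ D.eastEnd c r := by
  rcases D.southEnd_eq c r with heq | ⟨r', hr', hlt, heq⟩
  · exact heq ▸ (h.eastEnd_ne_colEnd r hr c hc le_rfl).symm
  · exact heq ▸ fun h' => hlt.ne (h.eastEnd_injOn hr' hr h')

theorem southEnd_le (h : D.Consistent c) (hc : c ∈ D.cols) : D.southEnd c c ≤ c :=
  (D.southEnd_le_iff _ _ _).2
    ⟨(D.colEnd_lt c hc).le, fun r hr hrc => h.eastEnd_le r hr hrc.le⟩

theorem eastEnd_pred_lt_southEnd (h : D.Consistent c) (hc : c ∈ D.cols) {r r' : ℤ}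
    (hr : r ∈ D.rows) (hrr' : r < r') (hrc : r < c) :
    D.eastEnd (c - 1) r < D.southEnd c r' := by
  rw [D.eastEnd_pred_of_lt hc hrc]
  calc min (D.southEnd c r) (D.eastEnd c r)
      < max (D.southEnd c r) (D.eastEnd c r) := min_lt_max.2 (h.southEnd_ne_eastEnd hc hr)
    _ = D.southEnd c (r + 1) := (D.southEnd_succ_of_mem c hr).symm
    _ ≤ D.southEnd c r' := D.southEnd_mono c hrr'

theorem top (D : PathEnds n) : D.Consistent n where
  le_eastEnd r hr := by
    rw [eastEnd_top]
    exact D.le_rowEnd r hr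
  eastEnd_le_rowEnd r _ := (D.eastEnd_top r).le
  eastEnd_mem r hr := by
    rw [eastEnd_top]
    exact D.rowEnd_mem r hr
  eastEnd_injOn := by
    rw [funext D.eastEnd_top]
    exact D.rowEnd_injOn
  eastEnd_ne_colEnd r hr c hc _ := by
    rw [eastEnd_top]
    exact D.rowEnd_ne_colEnd r hr c hc
  eastEnd_le r hr _ := by
    rw [eastEnd_top]
    rcases Finset.mem_union.1 (D.rowEnd_mem r hr) with hmem | hmem
    · exact (D.mem_rows_bounds hmem).2
    · exact (D.mem_cols_bounds hmem).2
  eastEnd_neg i hi hlt := absurd hlt (D.mem_cols_bounds hi).2.not_gt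

theorem pred_of_notMem (h : D.Consistent c) (hn : c ≤ n) (hc : c ∉ D.cols) :
    D.Consistent (c - 1) := by
  constructor <;> simp only [funext (D.eastEnd_pred_of_notMem hn hc)]
  · exact h.le_eastEnd
  · exact h.eastEnd_le_rowEnd
  · exact h.eastEnd_mem
  · exact h.eastEnd_injOn
  · exact fun r hr c' hc' hle => h.eastEnd_ne_colEnd r hr c' hc' (by omega)
  · intro r hr hrc
    have hle := h.eastEnd_le r hr (by omega)
    suffices D.eastEnd c r ≠ c by omega
    intro heq
    have hcrow : c ∈ D.rows := (Finset.mem_union.1 (heq ▸ h.eastEnd_mem r hr)).resolve_right hc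
    have hcend : D.eastEnd c c = c :=
      le_antisymm (h.eastEnd_le c hcrow le_rfl) (h.le_eastEnd c hcrow)
    have := h.eastEnd_injOn hr hcrow (heq.trans hcend.symm)
    omega
  · exact fun i hi hlt => h.eastEnd_neg i hi ((Int.sub_one_lt_iff.1 hlt).lt_of_ne
      fun heq => hc (heq ▸ hi))

theorem le_eastEnd_pred (h : D.Consistent c) (hc : c ∈ D.cols) {r : ℤ} (hr : r ∈ D.rows) :
    r ≤ D.eastEnd (c - 1) r := by
  rcases lt_or_ge r c with hrc | hcr
  · rw [D.eastEnd_pred_of_lt hc hrc]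
    exact le_min (h.le_southEnd hc hrc.le) (h.le_eastEnd r hr)
  · rw [D.eastEnd_pred_of_le (D.mem_cols_bounds hc).2 hcr]
    exact h.le_eastEnd r hr

theorem eastEnd_pred_ne_eastEnd (h : D.Consistent c) (hc : c ∈ D.cols) {r r' : ℤ}
    (hr : r ∈ D.rows) (hr' : r' ∈ D.rows) (hlt : r < r') :
    D.eastEnd (c - 1) r ≠ D.eastEnd c r' := by
  rcases D.eastEnd_pred_eq hc hr with heq | ⟨x, hx, hxr, heq⟩ <;> rw [heq]
  · exact (h.eastEnd_ne_colEnd r' hr' c hc le_rfl).symm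
  · exact fun hxr' => (hxr.trans_lt hlt).ne (h.eastEnd_injOn hx hr' hxr')

theorem eastEnd_pred_ne (h : D.Consistent c) (hc : c ∈ D.cols) {r r' : ℤ} (hr : r ∈ D.rows)
    (hr' : r' ∈ D.rows) (hlt : r < r') : D.eastEnd (c - 1) r ≠ D.eastEnd (c - 1) r' := by
  have hne := h.eastEnd_pred_ne_eastEnd hc hr hr' hlt
  rcases lt_or_ge r' c with hrc | hcr
  · rw [D.eastEnd_pred_of_lt hc hrc]
    rcases min_choice (D.southEnd c r') (D.eastEnd c r') with heq | heq <;> rw [heq]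
    · exact (h.eastEnd_pred_lt_southEnd hc hr hlt (by omega)).ne
    · exact hne
  · rwa [D.eastEnd_pred_of_le (D.mem_cols_bounds hc).2 hcr]

theorem southEnd_neg_le (h : D.Consistent c) (hc : c ∈ D.cols) (hdiag : D.colEnd c = -c) :
    D.southEnd c (-c) ≤ -c := by
  have hpos := (D.mem_cols_bounds hc).1
  refine (D.southEnd_le_iff _ _ _).2 ⟨hdiag.le, fun r hr hlt => ?_⟩
  rw [h.eastEnd_of_lt_neg hr (by omega) hlt]
  exact hlt.le

theorem eastEnd_pred_neg (h : D.Consistent c) (hc : c ∈ D.cols) : D.eastEnd (c - 1) (-c) = -c := by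
  obtain ⟨hpos, hn⟩ := D.mem_cols_bounds hc
  have hrow := D.neg_mem_rows hc
  refine le_antisymm ?_ (h.le_eastEnd_pred hc hrow)
  rcases D.diag c hc with hcol | hend
  · rw [D.eastEnd_pred_of_lt hc (by omega)]
    exact min_le_of_left_le (h.southEnd_neg_le hc hcol)
  · exact (D.eastEnd_pred_le hn _).trans ((h.eastEnd_le_rowEnd _ hrow).trans hend.le)

theorem pred_of_mem (h : D.Consistent c) (hc : c ∈ D.cols) : D.Consistent (c - 1) := by
  have hn := (D.mem_cols_bounds hc).2
  constructor
  · exact fun r hr => h.le_eastEnd_pred hc hr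
  · exact fun r hr => (D.eastEnd_pred_le hn r).trans (h.eastEnd_le_rowEnd r hr)
  · intro r hr
    rcases D.eastEnd_pred_eq hc hr with heq | ⟨r', hr', -, heq⟩ <;> rw [heq]
    · exact D.colEnd_mem c hc
    · exact h.eastEnd_mem r' hr'
  · intro r hr r' hr' heq
    by_contra hne
    rcases lt_or_gt_of_ne hne with hlt | hlt
    · exact h.eastEnd_pred_ne hc hr hr' hlt heq
    · exact h.eastEnd_pred_ne hc hr' hr hlt heq.symm
  · intro r hr c' hc' hlt
    rcases D.eastEnd_pred_eq hc hr with heq | ⟨r', hr', -, heq⟩ <;> rw [heq]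
    · exact fun hcol => (Int.le_sub_one_iff.1 hlt).ne' (D.colEnd_injOn hc hc' hcol)
    · exact h.eastEnd_ne_colEnd r' hr' c' hc' (by omega)
  · intro r hr hrc
    have hlt := h.eastEnd_pred_lt_southEnd hc hr (Int.le_sub_one_iff.1 hrc) (by omega)
    exact Int.le_sub_one_iff.2 (hlt.trans_le (h.southEnd_le hc))
  · intro i hi hci
    rcases (Int.sub_one_lt_iff.1 hci).eq_or_lt with rfl | hlt
    · exact h.eastEnd_pred_neg hc
    · refine le_antisymm ?_ (h.le_eastEnd_pred hc (D.neg_mem_rows hi))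
      exact (D.eastEnd_pred_le hn _).trans (h.eastEnd_neg i hi hlt).le

end Consistent

theorem consistent (D : PathEnds n) {c : ℤ} (hc : c ≤ n) : D.Consistent c := by
  induction c, hc using Int.leInductionDown with
  | base => exact .top D
  | pred c hc ih =>
    by_cases hcol : c ∈ D.cols
    · exact ih.pred_of_mem hcol
    · exact ih.pred_of_notMem hc hcol

theorem consistent_of_mem (D : PathEnds n) {c : ℤ} (hc : c ∈ D.cols) : D.Consistent c :=
  D.consistent (D.mem_cols_bounds hc).2

/-- The places of the `1`s in the tableau with the prescribed ends: two paths that meet touch if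
they are in the order of their ends, and cross otherwise. -/
noncomputable def ones (D : PathEnds n) : Finset (ℤ × ℤ) :=
  (D.rows ×ˢ D.cols).filter fun b => b.1 < b.2 ∧ D.southEnd b.2 b.1 < D.eastEnd b.2 b.1

theorem mem_ones (D : PathEnds n) {r c : ℤ} :
    (r, c) ∈ D.ones ↔ r ∈ D.rows ∧ c ∈ D.cols ∧ r < c ∧ D.southEnd c r < D.eastEnd c r := by
  simp only [ones, Finset.mem_filter, Finset.mem_product, and_assoc]

theorem isBox_of_mem_ones (D : PathEnds n) {r c : ℤ} (h : (r, c) ∈ D.ones) :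
    IsBox n D.cols r c := by
  obtain ⟨hr, hc, hrc, hlt⟩ := D.mem_ones.1 h
  refine ⟨mem_rowLabels.1 hr, hc, abs_le.2 ⟨?_, hrc.le⟩⟩
  by_contra! hneg
  have hpos := (D.mem_cols_bounds hc).1
  rw [(D.consistent_of_mem hc).eastEnd_of_lt_neg hr (by omega) hneg] at hlt
  have := D.colEnd_le_southEnd c r
  have := D.neg_le_colEnd c hc
  omega

theorem diag_mem_ones (D : PathEnds n) {c : ℤ} (hc : c ∈ D.cols) (hcol : D.colEnd c = -c) :
    (-c, c) ∈ D.ones := by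
  have hpos := (D.mem_cols_bounds hc).1
  have h := D.consistent_of_mem hc
  have hr := D.neg_mem_rows hc
  exact D.mem_ones.2 ⟨hr, hc, by omega, ((h.southEnd_neg_le hc hcol).trans
    (h.le_eastEnd _ hr)).lt_of_ne (h.southEnd_ne_eastEnd hc hr)⟩

theorem notMem_ones_of_rowEnd_eq (D : PathEnds n) {r : ℤ} (h : D.rowEnd r = r) (c : ℤ) :
    (r, c) ∉ D.ones := by
  intro hone
  obtain ⟨hr, hc, hrc, hlt⟩ := D.mem_ones.1 hone
  have hcon := D.consistent_of_mem hc
  have := hcon.eastEnd_le_rowEnd r hr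
  have := hcon.le_southEnd hc hrc.le
  omega

theorem exists_mem_ones (D : PathEnds n) {c : ℤ} (hc : c ∈ D.cols) : ∃ r, (r, c) ∈ D.ones := by
  have hlt : D.colEnd c < D.southEnd c c :=
    (D.colEnd_lt c hc).trans_le ((D.consistent_of_mem hc).le_southEnd hc le_rfl)
  let S := D.rows.filter fun r => r < c ∧ D.colEnd c < D.eastEnd c r
  have hS : S.Nonempty := by
    obtain ⟨r, hr, hrc, heq⟩ := (D.southEnd_eq c c).resolve_left hlt.ne'
    exact ⟨r, Finset.mem_filter.2 ⟨hr, hrc, heq ▸ hlt⟩⟩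
  obtain ⟨hr, hrc, hend⟩ := Finset.mem_filter.1 (S.min'_mem hS)
  refine ⟨S.min' hS, D.mem_ones.2 ⟨hr, hc, hrc, lt_of_le_of_lt ?_ hend⟩⟩
  refine (D.southEnd_le_iff _ _ _).2 ⟨le_rfl, fun r' hr' hlt' => ?_⟩
  by_contra! hend'
  exact hlt'.not_ge (S.min'_le r' (Finset.mem_filter.2 ⟨hr', hlt'.trans hrc, hend'⟩))

/-- All paths that enter column `c` from the west above row `r` end before the path in row `r`. -/
def IsRecord (D : PathEnds n) (c r : ℤ) : Prop :=
  ∀ r' ∈ D.rows, r' < r → D.eastEnd c r' < D.eastEnd c r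

theorem IsRecord.pred {D : PathEnds n} {c r : ℤ} (hc : c ≤ n) (h : D.IsRecord c r) :
    D.IsRecord (c - 1) r := by
  intro r' hr' hlt
  rw [D.eastEnd_pred hc r]
  split_ifs with hcase
  · exact lt_min ((D.consistent hc).eastEnd_pred_lt_southEnd hcase.1 hr' hlt (hlt.trans hcase.2))
      ((D.eastEnd_pred_le hc r').trans_lt (h r' hr' hlt))
  · exact (D.eastEnd_pred_le hc r').trans_lt (h r' hr' hlt)

theorem isRecord_of_mem_ones (D : PathEnds n) {r c c' : ℤ} (h : (r, c') ∈ D.ones)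
    (hc : c < c') : D.IsRecord c r := by
  obtain ⟨-, hc', hrc, hlt⟩ := D.mem_ones.1 h
  have hn := (D.mem_cols_bounds hc').2
  induction c, Int.le_sub_one_iff.2 hc using Int.leInductionDown with
  | base =>
    intro r' hr' hrr'
    rw [D.eastEnd_pred_of_lt hc' hrc, min_eq_left hlt.le]
    exact (D.consistent hn).eastEnd_pred_lt_southEnd hc' hr' hrr' (hrr'.trans hrc)
  | pred c hcc' ih => exact (ih (by omega)).pred (by omega)

theorem IsRecord.mem_ones {D : PathEnds n} {r r' c : ℤ} (h : D.IsRecord c r) (hr : r ∈ D.rows)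
    (hrc : r < c) (habove : (r', c) ∈ D.ones) (hlt : r' < r) : (r, c) ∈ D.ones := by
  obtain ⟨hr', hc, -, hend⟩ := D.mem_ones.1 habove
  refine D.mem_ones.2 ⟨hr, hc, hrc, (D.southEnd_lt_iff _ _ _).2 ⟨?_, h⟩⟩
  exact (D.colEnd_le_southEnd c r').trans_lt (hend.trans (h r' hr' hlt))

/-- The tableau whose paths have the prescribed ends. -/
noncomputable def tableau (D : PathEnds n) : PermTableauB n where
  cols := D.cols
  cols_subset := D.cols_subset
  ones := D.ones
  ones_isBox _ _ := D.isBox_of_mem_ones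
  exists_one _ := D.exists_mem_ones
  hinge r c r' c' hbox hlt habove hc hleft := by
    have hr := (D.mem_ones.1 hleft).1
    have hrc : r < c := (abs_le.1 hbox.2.2).2.lt_of_ne
      fun heq => D.notMem_cols_of_mem_rows hr (heq ▸ hbox.2.1)
    exact (D.isRecord_of_mem_ones hleft hc).mem_ones hr hrc habove hlt
  diag i hi hzero :=
    D.notMem_ones_of_rowEnd_eq ((D.diag i hi).resolve_left (mt (D.diag_mem_ones hi) hzero))

/-- The prescribed end of the path through a position. -/
noncomputable def endOf (D : PathEnds n) (s : ZState) : ℤ :=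
  match s.dir with
  | .east => D.eastEnd s.col s.row
  | .south => D.southEnd s.col s.row

theorem endOf_step_of_mem (D : PathEnds n) {d : Dir} {r c : ℤ} (h : (r, c) ∈ D.ones) :
    D.endOf (D.tableau.step ⟨d, r, c⟩) = D.endOf ⟨d, r, c⟩ := by
  obtain ⟨hr, hc, hrc, hlt⟩ := D.mem_ones.1 h
  have hstep := D.tableau.step_of_mem h
  cases d
  · rw [hstep.1]
    exact (D.southEnd_succ_of_mem c hr).trans (max_eq_right hlt.le)
  · rw [hstep.2]
    exact (D.eastEnd_pred_of_lt hc hrc).trans (min_eq_left hlt.le)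

theorem endOf_step_of_notMem (D : PathEnds n) {d : Dir} {r c : ℤ} (h : (r, c) ∉ D.ones)
    (hs : D.tableau.Valid ⟨d, r, c⟩) (hrc : r < c) (hn : c ≤ n) :
    D.endOf (D.tableau.step ⟨d, r, c⟩) = D.endOf ⟨d, r, c⟩ := by
  have hstep := D.tableau.step_of_notMem h
  have hle (hr : r ∈ D.rows) (hc : c ∈ D.cols) : D.eastEnd c r ≤ D.southEnd c r :=
    not_lt.1 fun hlt => h (D.mem_ones.2 ⟨hr, hc, hrc, hlt⟩)
  cases d
  · have hr : r ∈ D.rows := mem_rowLabels.2 hs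
    rw [hstep.1]
    by_cases hc : c ∈ D.cols
    · exact (D.eastEnd_pred_of_lt hc hrc).trans (min_eq_right (hle hr hc))
    · exact D.eastEnd_pred_of_notMem hn hc r
  · have hc : c ∈ D.cols := hs
    rw [hstep.2]
    by_cases hr : r ∈ D.rows
    · exact (D.southEnd_succ_of_mem c hr).trans (max_eq_left (hle hr hc))
    · exact D.southEnd_succ_of_notMem c hr

theorem endOf_step (D : PathEnds n) {s : ZState} (hs : D.tableau.Valid s) (h : s.row < s.col)
    (hn : s.col ≤ n) : D.endOf (D.tableau.step s) = D.endOf s := by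
  by_cases hone : (s.row, s.col) ∈ D.ones
  · exact D.endOf_step_of_mem hone
  · exact D.endOf_step_of_notMem hone hs h hn

theorem endLabel_tableau (D : PathEnds n) {s : ZState} (hs : D.tableau.Valid s)
    (hrc : s.row ≤ s.col) (hn : s.col ≤ n) : D.tableau.endLabel s = D.endOf s := by
  obtain ⟨m, hm⟩ : ∃ m : ℕ, s.col - s.row = m := ⟨(s.col - s.row).toNat, by omega⟩
  induction m generalizing s with
  | zero =>
    obtain ⟨d, r, c⟩ := s
    obtain rfl : c = r := by simpa only [Nat.cast_zero, sub_eq_zero] using hm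
    rw [D.tableau.endLabel_of_col_eq_row rfl]
    have h := D.consistent hn
    cases d with
    | east =>
      have hr : c ∈ D.rows := mem_rowLabels.2 hs
      exact le_antisymm (h.le_eastEnd c hr) (h.eastEnd_le c hr le_rfl)
    | south => exact le_antisymm (h.le_southEnd hs le_rfl) (h.southEnd_le hs)
  | succ m ih =>
    have hlt : s.row < s.col := by omega
    have hdiff := D.tableau.step_diff s
    rw [← D.tableau.endLabel_step hlt, ← D.endOf_step hs hlt hn]
    exact ih (D.tableau.valid_step hs) (by omega) ((D.tableau.iterate_col_le s 1).trans hn)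
      (by omega)

theorem endLabel_rowStart (D : PathEnds n) {r : ℤ} (hr : r ∈ D.rows) :
    D.tableau.endLabel (PermTableauB.rowStart n r) = D.rowEnd r := by
  rw [D.endLabel_tableau (s := PermTableauB.rowStart n r) (mem_rowLabels.1 hr)
    (D.mem_rows_bounds hr).2 le_rfl]
  exact D.eastEnd_top r

theorem endLabel_colStart (D : PathEnds n) {c : ℤ} (hc : c ∈ D.cols) :
    D.tableau.endLabel (PermTableauB.colStart n c) = D.colEnd c := by
  obtain ⟨hpos, hn⟩ := D.mem_cols_bounds hc
  rw [D.endLabel_tableau (s := PermTableauB.colStart n c) hc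
    (by simp only [PermTableauB.colStart]; omega) hn]
  refine (D.southEnd_eq c (-n)).resolve_right fun ⟨r, hr, hlt, _⟩ => ?_
  exact hlt.not_ge (D.mem_rows_bounds hr).1

theorem zetaPos_tableau (D : PathEnds n) {i : ℤ} (hi : 1 ≤ i) (hi' : i ≤ n) :
    D.tableau.zetaPos i =
      if i ∉ D.cols then D.rowEnd i
      else if D.colEnd i = -i then -D.rowEnd (-i) else D.colEnd i := by
  unfold PermTableauB.zetaPos
  change (if i ∉ D.cols then _ else if (-i, i) ∉ D.ones then _ else _) = _
  by_cases hcol : i ∈ D.cols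
  · rw [if_neg (not_not.2 hcol), if_neg (not_not.2 hcol), D.endLabel_colStart hcol,
      D.endLabel_rowStart (D.neg_mem_rows hcol)]
    by_cases hend : D.colEnd i = -i
    · rw [if_pos hend, if_neg (not_not.2 (D.diag_mem_ones hcol hend))]
    · rw [if_neg hend,
        if_pos (D.notMem_ones_of_rowEnd_eq ((D.diag i hcol).resolve_left hend) i)]
  · rw [if_pos hcol, if_pos hcol]
    exact D.endLabel_rowStart (mem_rowLabels.2 (Or.inl ⟨hi, hi', hcol⟩))

end PathEnds

namespace SignedPerm

variable {n : ℕ}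

/-- The labels `i ∈ [n]` of the columns of the tableau of `σ`. -/
noncomputable def cols (σ : SignedPerm n) : Finset ℤ :=
  (Finset.Icc 1 (n : ℤ)).filter fun i => toPerm σ i < i

/-- The end of the path from row `r` in the tableau of `σ`. -/
noncomputable def rowEnd (σ : SignedPerm n) (r : ℤ) : ℤ :=
  if 0 < toPerm σ r then toPerm σ r else r

/-- The end of the path from column `c` in the tableau of `σ`. -/
noncomputable def colEnd (σ : SignedPerm n) (c : ℤ) : ℤ :=
  if 0 < toPerm σ c then toPerm σ c else -c

variable {σ : SignedPerm n}

theorem mem_cols {i : ℤ} : i ∈ cols σ ↔ 1 ≤ i ∧ i ≤ n ∧ toPerm σ i < i := by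
  simp only [cols, Finset.mem_filter, Finset.mem_Icc, and_assoc]

theorem mem_rowLabels_cols {r : ℤ} : r ∈ rowLabels n (cols σ) ↔
    (1 ≤ r ∧ r ≤ n ∧ r ≤ toPerm σ r) ∨ (r ≤ -1 ∧ -(n : ℤ) ≤ r ∧ r < toPerm σ r) := by
  have := toPerm_neg σ r
  rw [mem_rowLabels, IsRowLabel, mem_cols, mem_cols]
  omega

theorem mem_labels_of_mem_Icc {i : ℤ} (hi : 1 ≤ i) (hi' : i ≤ n) :
    i ∈ rowLabels n (cols σ) ∪ cols σ := by
  rw [Finset.mem_union, mem_rowLabels_cols, mem_cols]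
  omega

theorem rowEnd_mem {r : ℤ} (hr : r ∈ rowLabels n (cols σ)) :
    rowEnd σ r ∈ rowLabels n (cols σ) ∪ cols σ := by
  unfold rowEnd
  split_ifs with hpos
  · rw [mem_rowLabels_cols] at hr
    exact mem_labels_of_mem_Icc hpos (toPerm_mem σ (by omega)).2.2
  · exact Finset.mem_union_left _ hr

theorem colEnd_mem {c : ℤ} (hc : c ∈ cols σ) : colEnd σ c ∈ rowLabels n (cols σ) ∪ cols σ := by
  unfold colEnd
  split_ifs with hpos
  · rw [mem_cols] at hc
    exact mem_labels_of_mem_Icc hpos (toPerm_mem σ (by omega)).2.2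
  · exact Finset.mem_union_left _ (mem_rowLabels.2 (Or.inr (by rwa [neg_neg])))

theorem rowEnd_injOn : Set.InjOn (rowEnd σ) (rowLabels n (cols σ)) := by
  intro r hr r' hr' h
  rw [Finset.mem_coe, mem_rowLabels_cols] at hr hr'
  unfold rowEnd at h
  split_ifs at h
  · exact (toPerm σ).injective h
  · omega
  · omega
  · exact h

theorem colEnd_injOn : Set.InjOn (colEnd σ) (cols σ) := by
  intro c hc c' hc' h
  rw [Finset.mem_coe, mem_cols] at hc hc'
  unfold colEnd at h
  split_ifs at h
  · exact (toPerm σ).injective h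
  · omega
  · omega
  · exact neg_injective h

theorem rowEnd_ne_colEnd {r c : ℤ} (hr : r ∈ rowLabels n (cols σ)) (hc : c ∈ cols σ) :
    rowEnd σ r ≠ colEnd σ c := by
  rw [mem_rowLabels_cols] at hr
  rw [mem_cols] at hc
  intro h
  unfold rowEnd colEnd at h
  split_ifs at h
  · obtain rfl := (toPerm σ).injective h
    omega
  · omega
  · omega
  · subst h
    have := toPerm_neg σ c
    have := (toPerm_mem σ (z := c) (by omega)).1
    omega

/-- The ends of the paths in the tableau of `σ`. -/
noncomputable def pathEnds (σ : SignedPerm n) : PathEnds n where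
  cols := cols σ
  cols_subset := Finset.filter_subset _ _
  rowEnd := rowEnd σ
  colEnd := colEnd σ
  rowEnd_mem _ := rowEnd_mem
  colEnd_mem _ := colEnd_mem
  le_rowEnd r hr := by
    rw [mem_rowLabels_cols] at hr
    unfold rowEnd
    split_ifs <;> omega
  colEnd_lt c hc := by
    rw [mem_cols] at hc
    unfold colEnd
    split_ifs <;> omega
  neg_le_colEnd c hc := by
    rw [mem_cols] at hc
    unfold colEnd
    split_ifs <;> omega
  rowEnd_injOn := rowEnd_injOn
  colEnd_injOn := colEnd_injOn
  rowEnd_ne_colEnd _ hr _ hc := rowEnd_ne_colEnd hr hc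
  diag c _ := by
    have := toPerm_neg σ c
    unfold rowEnd colEnd
    split_ifs <;> omega

theorem zeta_pathEnds (σ : SignedPerm n) : (pathEnds σ).tableau.zeta = σ := by
  refine ext_toPerm fun i hi hi' => ?_
  rw [PermTableauB.toPerm_zeta _ hi hi', PathEnds.zetaPos_tableau _ hi hi']
  have hneg := toPerm_neg σ i
  have hne := (toPerm_mem σ (z := i) (by omega)).1
  simp only [pathEnds, rowEnd, colEnd, mem_cols]
  split_ifs <;> omega

end SignedPerm

theorem theorem4p3 (n : ℕ) (σ : SignedPerm n) :
    (∃! T : PermTableauB n, T.zeta = σ) ∧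
    ∀ T : PermTableauB n, T.zeta = σ →
      SignedPerm.length σ = SignedPerm.inv σ ∧
        SignedPerm.inv σ = 2 * (T.zeroEE + T.zeroNN) + T.one := by
  have hex := SignedPerm.zeta_pathEnds σ
  refine ⟨⟨(SignedPerm.pathEnds σ).tableau, hex, fun T hT => ?_⟩, ?_⟩
  · exact PermTableauB.zeta_injective (hT.trans hex.symm)
  · rintro T rfl
    exact ⟨SignedPerm.length_eq_inv _, T.inv_zeta⟩
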